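/- Let $G$ be a finite connected plane graph (loops and multiple edges allowed, drawn on the sphere, so that the exterior face counts as a face) in which every vertex has degree $4$. A central circuit of $G$ is a closed walk that leaves each vertex by the edge opposite to the one by which it entered; it is simple if it visits no vertex twice. A patch $A$ is a region, i.e. a set of faces of $G$, whose boundary is a circle (a closed walk in $G$ without repeated vertices) divided into $q\ge 0$ arcs, each arc being a path of edges belonging to a central circuit; for $q=0$ the boundary is one whole simple central circuit. The patch, with its $q$ arcs, is regular if the continuation of each arc beyond either of its two ends (along its central circuit) lies outside of the patch. If $p'_k$ is the number of $k$-gonal faces in $A$, the curvature of $A$ is $c(A)=\sum_{k\ge 1}(4-k)\,p'_k$. Unions of patches below are unions of patches that have no face in common. Then: (i) If $A$ is a regular patch bounded by $q$ arcs, then $c(A)=4-q$. Moreover: (i.1) for $A$ regular, $c(A)=4$ if and only if $A$ is bounded by a simple central circuit; (i.2) for $A$ regular, if $A$ is a rectangle ($a\times b$ grid, $a,b\ge 1$) formed by $4$-gons put together, then $c(A)=0$; and if all faces of $A$ have at most $4$ sides, then $c(A)=0$ if and only if $A$ is a rectangle formed by $4$-gons put together. (ii) If $G$ is $2$-connected (it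 has no loop, and deleting any vertex leaves a connected graph), then any patch $A$ is the union of regular patches $A_1,\dots,A_p$. Whether or not $G$ is $2$-connected, whenever a patch $A$ is the union of regular patches $A_1,\dots,A_p$, where $A_i$ is bounded by $q_i$ arcs, one has $c(A)=(4-q_1)+\dots+(4-q_p)$. (iii) If $G$ is the union of patches $A_1,\dots,A_p$, then $c(A_1)+\dots+c(A_p)=8$. -/

import Mathlib

/-- A finite graph (loops and multiple edges allowed) drawn on an oriented closed surface with
faces that are discs, given by its rotation system. `D` is the set of darts (oriented edges),
`rot` sends a dart to the next dart counterclockwise around its initial vertex, and `rev`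
reverses a dart. -/
structure CombMap (D : Type*) where
  rot : Equiv.Perm D
  rev : Equiv.Perm D
  rev_rev : ∀ d, rev (rev d) = d
  rev_ne : ∀ d, rev d ≠ d

namespace CombMap

variable {D : Type*} (G : CombMap D)

/-- Walking along the boundary of the face on the left of a dart: at the terminal vertex take the
leftmost turn. -/
def next : Equiv.Perm D := G.rot⁻¹ * G.rev

/-- Vertices are the cycles of `rot`. -/
abbrev Vertex : Type _ := Quotient (Equiv.Perm.SameCycle.setoid G.rot)

/-- Edges are the cycles of `rev`, that is, the pairs `{d, rev d}`. -/
abbrev Edge : Type _ := Quotient (Equiv.Perm.SameCycle.setoid G.rev)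

/-- Faces are the cycles of `next`. -/
abbrev Face : Type _ := Quotient (Equiv.Perm.SameCycle.setoid G.next)

/-- The initial vertex of a dart. -/
def tail (d : D) : G.Vertex := Quotient.mk _ d

/-- The terminal vertex of a dart. -/
def head (d : D) : G.Vertex := G.tail (G.rev d)

/-- The face on the left of a dart. -/
def left (d : D) : G.Face := Quotient.mk _ d

/-- The degree of a vertex (a loop counts twice). -/
noncomputable def degree (v : G.Vertex) : ℕ := Nat.card {d : D // G.tail d = v}

/-- The number of sides of a face (an edge with the face on both sides counts twice). -/
noncomputable def size (F : G.Face) : ℕ := Nat.card {d : D // G.left d = F}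

/-- The underlying simple graph on the vertices. -/
def graph : SimpleGraph G.Vertex where
  Adj u v := u ≠ v ∧ ∃ d, G.tail d = u ∧ G.head d = v
  symm := ⟨by
    rintro u v ⟨h, d, rfl, rfl⟩
    exact ⟨h.symm, G.rev d, rfl, by simp [head, G.rev_rev]⟩⟩
  loopless := ⟨fun _ h => h.1 rfl⟩

/-- Connected plane graphs: connected maps on the sphere, that is, of Euler characteristic `2`. -/
structure IsPlane : Prop where
  connected : G.graph.Connected
  euler : (Nat.card G.Vertex : ℤ) - Nat.card G.Edge + Nat.card G.Face = 2

/-- All vertices have degree `4`. -/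
def FourValent : Prop := ∀ v, G.degree v = 4

/-- A 2-connected graph: there is no loop, and deleting any vertex leaves a connected graph. -/
structure TwoConnected : Prop where
  no_loop : ∀ d, G.tail d ≠ G.head d
  connected : ∀ v : G.Vertex, (G.graph.induce {u | u ≠ v}).Connected

/-- In a 4-valent graph: after the dart `d`, continue by the edge opposite the entering one. -/
def straight : Equiv.Perm D := G.rot * G.rot * G.rev

/-- `C` is the set of darts of a central circuit traversed in one of its two directions. -/
def IsCentralCircuit (C : Set D) : Prop := ∃ d, C = {e | G.straight.SameCycle d e}

/-- A central circuit is simple if it passes at most once through every vertex. -/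
def IsSimpleCentralCircuit (C : Set D) : Prop := G.IsCentralCircuit C ∧ Set.InjOn G.tail C

/-- The oriented boundary of a set of faces: the darts with a face of `A` on the left and a face
not in `A` on the right. -/
def boundary (A : Set G.Face) : Set D := {d | G.left d ∈ A ∧ G.left (G.rev d) ∉ A}

/-- The edge of `d` lies outside of the (closed) region `A`. -/
def Outside (A : Set G.Face) (d : D) : Prop := G.left d ∉ A ∧ G.left (G.rev d) ∉ A

/-- The set of faces `A` is a region bounded by `q` arcs of central circuits that together form a
circle. The circle is a closed walk without repeated vertices, which runs through the boundary of
`A`. The set `breaks` of `q` of its indices marks the last edges of the arcs: everywhere else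
the walk follows a central circuit. If `q = 0`, the circle is a whole central circuit. -/
structure PatchBoundary (A : Set G.Face) (q : ℕ) where
  len : ℕ
  len_pos : 0 < len
  circle : ZMod len → D
  closed : ∀ i, G.head (circle i) = G.tail (circle (i + 1))
  simple : Function.Injective fun i => G.tail (circle i)
  range_eq : Set.range circle = G.boundary A
  breaks : Finset (ZMod len)
  card_breaks : breaks.card = q
  straight_of_notMem : ∀ i, i ∉ breaks → circle (i + 1) = G.straight (circle i)

/-- The continuation of each bounding arc beyond either of its ends lies outside of the patch. -/
def PatchBoundary.Regular {G : CombMap D} {A : Set G.Face} {q : ℕ}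
    (b : G.PatchBoundary A q) : Prop :=
  ∀ i ∈ b.breaks, G.Outside A (G.straight (b.circle i)) ∧
    G.Outside A (G.rot (G.rot (b.circle (i + 1))))

/-- `A` is (the set of faces of) a patch. -/
def IsPatch (A : Set G.Face) : Prop := ∃ q, Nonempty (G.PatchBoundary A q)

/-- `A` is (the set of faces of) a regular patch bounded by `q` arcs. -/
def IsRegularPatch (A : Set G.Face) (q : ℕ) : Prop := ∃ b : G.PatchBoundary A q, b.Regular

/-- The p-vector: the number of `k`-gonal faces in `A`. -/
noncomputable def pVector (A : Set G.Face) (k : ℕ) : ℕ := {F ∈ A | G.size F = k}.ncard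

/-- The curvature `∑_{k ≥ 1} (4 - k) p'_k`; no face has more than `Nat.card D` sides. -/
noncomputable def curvature (A : Set G.Face) : ℤ :=
  ∑ k ∈ Finset.Icc 1 (Nat.card D), (4 - (k : ℤ)) * G.pVector A k

/-- `A` is an `a × b` rectangle formed by 4-gons put together. The dart `f i j` is the lower side
of the 4-gon in column `i` and row `j`, run through from left to right, so that the next three
darts around that 4-gon are its right, upper and left sides. -/
structure IsGrid (A : Set G.Face) (a b : ℕ) (f : ℕ → ℕ → D) : Prop where
  pos_left : 0 < a
  pos_right : 0 < b
  faces : A = {F | ∃ i < a, ∃ j < b, G.left (f i j) = F}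
  inj : ∀ i < a, ∀ j < b, ∀ i' < a, ∀ j' < b,
    G.left (f i j) = G.left (f i' j') → i = i' ∧ j = j'
  size_eq : ∀ i < a, ∀ j < b, G.size (G.left (f i j)) = 4
  glue_right : ∀ i j, i + 1 < a → j < b →
    G.rev (G.next (f i j)) = G.next (G.next (G.next (f (i + 1) j)))
  glue_up : ∀ i j, i < a → j + 1 < b → G.rev (G.next (G.next (f i j))) = f i (j + 1)
  lower : ∀ i < a, G.left (G.rev (f i 0)) ∉ A
  upper : ∀ i < a, G.left (G.rev (G.next (G.next (f i (b - 1))))) ∉ A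
  left_side : ∀ j < b, G.left (G.rev (G.next (G.next (G.next (f 0 j))))) ∉ A
  right_side : ∀ j < b, G.left (G.rev (G.next (f (a - 1) j))) ∉ A

/-- `A` is a rectangle formed by 4-gons put together. -/
def IsRectangle (A : Set G.Face) : Prop := ∃ a b f, G.IsGrid A a b f

/-- `A` is the union of the `B i`, which do not overlap (they share no face). -/
def IsTiling {p : ℕ} (B : Fin p → Set G.Face) (A : Set G.Face) : Prop :=
  Pairwise (fun i j => Disjoint (B i) (B j)) ∧ ⋃ i, B i = A

end CombMap

/-! The curvature is found by counting darts. If `N` darts have a face of the regular patch `A` on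
their left, then `c(A) = 4F - N`. Counting by edges gives `2E = N + len`, as a boundary edge has
only one dart with `A` on its left. Counting by vertices gives `4V = N + 2 len + q`, as a vertex of
the circle has two of its four sectors outside `A`, and three at a corner. A patch is a disc, so `V
- E + F = 1`, and `c(A) = 4 - q` follows. The disc formula is homology modulo 2: Euler
characteristic 2 makes every cycle on the sphere bound, and connectedness of the patch and of its
complement carries this over to the patch.

If `c(A) = 0` and no face has more than four sides, then `q = 4` and all faces are 4-gons. Rows of
4-gons are stacked on one side of `A` until a row leaves `A`; at inner edges regularity keeps the
boundary straight, so the stack has its four sides in the boundary. These sides close up, and having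
four breaks forces the circle to be as long as all of them together. Hence the 4-gons are distinct,
and by connectedness they fill `A`.

In a 2-connected graph no face meets a vertex twice: a closed curve through that face and vertex
would separate the rest of the graph. So each face alone is a regular patch. Curvature is additive
over tilings, and the same count on the whole sphere gives 8. -/

/-! ### Cycles of a permutation. -/

namespace Equiv.Perm

variable {D : Type*} [Finite D] {σ : Equiv.Perm D} {x y : D}

/-- Turns degrees and face sizes into periods of `rot` and `next`. -/
theorem minimalPeriod_eq_card_sameCycle {D : Type*} (σ : Equiv.Perm D) (x : D) :
    Function.minimalPeriod σ x = Nat.card {e // σ.SameCycle x e} := by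
  have h : Function.minimalPeriod σ x =
      Nat.card (MulAction.orbit (Subgroup.zpowers σ) x) := by
    rw [Nat.card_congr (MulAction.orbitZPowersEquiv σ x), Nat.card_zmod]
    rfl
  rw [h]
  refine Nat.card_congr (Equiv.subtypeEquivRight fun e => ?_)
  constructor
  · rintro ⟨⟨_, k, rfl⟩, rfl⟩
    exact ⟨k, rfl⟩
  · rintro ⟨k, rfl⟩
    exact ⟨⟨_, k, rfl⟩, rfl⟩

theorem SameCycle.exists_lt_minimalPeriod (h : σ.SameCycle x y) :
    ∃ k < Function.minimalPeriod σ x, (σ ^ k) x = y := by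
  obtain ⟨k, rfl⟩ := h.exists_nat_pow_eq
  refine ⟨k % Function.minimalPeriod σ x, Nat.mod_lt _ ?_, ?_⟩
  · refine Function.IsPeriodicPt.minimalPeriod_pos (n := orderOf σ) (orderOf_pos σ) ?_
    rw [Function.IsPeriodicPt, Function.IsFixedPt, Equiv.Perm.iterate_eq_pow, pow_orderOf_eq_one]
    rfl
  · rw [← Equiv.Perm.iterate_eq_pow, ← Equiv.Perm.iterate_eq_pow,
      Function.iterate_mod_minimalPeriod_eq]

theorem SameCycle.eq_of_forall_apply_eq {D α : Type*} {σ : Equiv.Perm D} {x y : D}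
    (h : σ.SameCycle x y) {f : D → α} (hf : ∀ d, f (σ d) = f d) : f x = f y := by
  obtain ⟨k, rfl⟩ := h
  induction k using Int.induction_on with
  | zero => rfl
  | succ k ih => rw [add_comm, zpow_add, zpow_one, Equiv.Perm.mul_apply, hf, ih]
  | pred k ih =>
    rw [ih, sub_eq_neg_add, zpow_add, ← hf ((σ ^ (-1 : ℤ) * _) x)]
    simp

end Equiv.Perm

/-! ### Local structure of darts, vertices and faces. -/

namespace CombMap

variable {D : Type*} (G : CombMap D)

/-- The edge of a dart. -/
def edge (d : D) : G.Edge := Quotient.mk _ d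

theorem tail_eq_iff {x y : D} : G.tail x = G.tail y ↔ G.rot.SameCycle x y := Quotient.eq

theorem left_eq_iff {x y : D} : G.left x = G.left y ↔ G.next.SameCycle x y := Quotient.eq

theorem left_surjective : Function.Surjective G.left := Quotient.mk_surjective

theorem edge_surjective : Function.Surjective G.edge := Quotient.mk_surjective

theorem rot_next (d : D) : G.rot (G.next d) = G.rev d := by simp [next]

theorem next_eq (d : D) : G.next d = G.rot⁻¹ (G.rev d) := rfl

theorem next_rev (d : D) : G.next (G.rev d) = G.rot⁻¹ d := by simp [next, G.rev_rev]

theorem straight_eq (d : D) : G.straight d = G.rot (G.rot (G.rev d)) := rfl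

@[simp] theorem tail_rot (d : D) : G.tail (G.rot d) = G.tail d :=
  (G.tail_eq_iff.2 (Equiv.Perm.SameCycle.refl _ _).apply_right).symm

@[simp] theorem tail_rot_symm (d : D) : G.tail (G.rot.symm d) = G.tail d := by
  rw [← G.tail_rot, Equiv.apply_symm_apply]

@[simp] theorem left_next (d : D) : G.left (G.next d) = G.left d :=
  (G.left_eq_iff.2 (Equiv.Perm.SameCycle.refl _ _).apply_right).symm

theorem left_rev (d : D) : G.left (G.rev d) = G.left (G.rot⁻¹ d) := by
  rw [← G.left_next (G.rev d), next_rev]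

theorem left_rev_rot (d : D) : G.left (G.rev (G.rot d)) = G.left d := by
  rw [left_rev]; simp

theorem tail_next (d : D) : G.tail (G.next d) = G.head d := by
  rw [← G.tail_rot, rot_next]; rfl

theorem tail_straight (d : D) : G.tail (G.straight d) = G.head d := by
  simp [straight_eq, head]

theorem head_rev (d : D) : G.head (G.rev d) = G.tail d := by simp [head, G.rev_rev]

theorem edge_eq_iff {x y : D} : G.edge x = G.edge y ↔ y = x ∨ y = G.rev x := by
  constructor
  · intro h
    obtain ⟨k, rfl⟩ : G.rev.SameCycle x y := Quotient.eq.1 h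
    have h2 : G.rev ^ (2 : ℤ) = 1 := by
      ext d; exact G.rev_rev d
    obtain ⟨m, rfl | rfl⟩ := Int.even_or_odd' k
    · left; simp [zpow_mul, h2]
    · right; simp [zpow_add, zpow_mul, h2]
  · rintro (rfl | rfl)
    · rfl
    · exact Quotient.sound (Equiv.Perm.SameCycle.refl _ _).apply_right

@[simp] theorem edge_rev (d : D) : G.edge (G.rev d) = G.edge d :=
  (G.edge_eq_iff.2 (Or.inr rfl)).symm

theorem card_edge_fiber (e : G.Edge) : Nat.card {d // G.edge d = e} = 2 := by
  obtain ⟨d, rfl⟩ := G.edge_surjective e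
  have : {e | G.edge e = G.edge d} = {d, G.rev d} := by
    ext x
    rw [Set.mem_ofPred_eq, eq_comm, edge_eq_iff]
    rfl
  rw [← Set.ncard_pair (G.rev_ne d).symm, ← this]
  rfl

section FourValent

variable {G}

theorem minimalPeriod_rot (h : G.FourValent) (d : D) : Function.minimalPeriod G.rot d = 4 := by
  rw [Equiv.Perm.minimalPeriod_eq_card_sameCycle, ← h (G.tail d), degree]
  exact Nat.card_congr (Equiv.subtypeEquivRight fun e => by
    rw [eq_comm (a := G.tail e), tail_eq_iff])

theorem minimalPeriod_next (d : D) : Function.minimalPeriod G.next d = G.size (G.left d) := by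
  rw [Equiv.Perm.minimalPeriod_eq_card_sameCycle, size]
  exact Nat.card_congr (Equiv.subtypeEquivRight fun e => by
    rw [eq_comm (a := G.left e), left_eq_iff])

theorem rot_rot_rot_rot (h : G.FourValent) (d : D) : G.rot (G.rot (G.rot (G.rot d))) = d := by
  have := Function.iterate_minimalPeriod (f := G.rot) (x := d)
  rwa [minimalPeriod_rot h] at this

theorem rot_inv_eq (h : G.FourValent) (d : D) : G.rot⁻¹ d = G.rot (G.rot (G.rot d)) := by
  rw [Equiv.Perm.inv_eq_iff_eq, rot_rot_rot_rot h]

theorem rot_ne (h : G.FourValent) (d : D) : G.rot d ≠ d := fun h1 => by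
  have := Function.IsPeriodicPt.minimalPeriod_le (f := G.rot) (x := d) one_pos h1
  rw [minimalPeriod_rot h] at this
  omega

theorem rot_rot_ne (h : G.FourValent) (d : D) : G.rot (G.rot d) ≠ d := fun h1 => by
  have := Function.IsPeriodicPt.minimalPeriod_le (f := G.rot) (x := d) two_pos h1
  rw [minimalPeriod_rot h] at this
  omega

theorem eq_of_tail_eq [Finite D] (h : G.FourValent) {x y : D} (hxy : G.tail x = G.tail y) :
    y = x ∨ y = G.rot x ∨ y = G.rot (G.rot x) ∨ y = G.rot (G.rot (G.rot x)) := by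
  obtain ⟨k, hk, rfl⟩ := (G.tail_eq_iff.1 hxy).exists_lt_minimalPeriod
  rw [minimalPeriod_rot h] at hk
  interval_cases k <;> simp [pow_succ]

theorem next_of_size_eq_four {d : D} (h : G.size (G.left d) = 4) :
    G.next (G.next (G.next (G.next d))) = d := by
  have := Function.iterate_minimalPeriod (f := G.next) (x := d)
  rwa [minimalPeriod_next, h] at this

theorem eq_of_left_eq [Finite D] {x y : D} (hs : G.size (G.left x) = 4) (hxy : G.left x = G.left y) :
    y = x ∨ y = G.next x ∨ y = G.next (G.next x) ∨ y = G.next (G.next (G.next x)) := by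
  obtain ⟨k, hk, rfl⟩ := (G.left_eq_iff.1 hxy).exists_lt_minimalPeriod
  rw [minimalPeriod_next, hs] at hk
  interval_cases k <;> simp [pow_succ]

/-- Both sides are `rot⁻²` and `rot²` of the same dart. In this form `straight` crosses the edge
`next d` and so leads from the lower side of a 4-gon to that of its right neighbour. -/
theorem straight_eq_next_rev_next (h : G.FourValent) (d : D) :
    G.straight d = G.next (G.rev (G.next d)) := by
  rw [next_rev, next_eq, rot_inv_eq h, rot_inv_eq h, rot_rot_rot_rot h]
  rfl

end FourValent

/-! ### Curvature as a count of darts. -/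

section Counting

variable [Finite D]

theorem size_pos (F : G.Face) : 0 < G.size F := by
  obtain ⟨d, rfl⟩ := G.left_surjective F
  have : Nonempty {e // G.left e = G.left d} := ⟨⟨d, rfl⟩⟩
  exact Nat.card_pos

theorem size_le (F : G.Face) : G.size F ≤ Nat.card D :=
  Nat.card_le_card_of_injective _ Subtype.val_injective

theorem curvature_eq_finsum (A : Set G.Face) :
    G.curvature A = ∑ᶠ F ∈ A, (4 - (G.size F : ℤ)) := by
  classical
  rw [finsum_mem_eq_finite_toFinset_sum _ A.toFinite, curvature,
    ← Finset.sum_fiberwise_of_maps_to (t := Finset.Icc 1 (Nat.card D)) (g := G.size)]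
  · refine Finset.sum_congr rfl fun k _ => ?_
    rw [Finset.sum_congr rfl (g := fun _ => 4 - (k : ℤ)), Finset.sum_const, nsmul_eq_mul, mul_comm,
      pVector, Set.ncard_eq_toFinset_card _ (Set.toFinite _)]
    · congr 3
      ext F
      simp
    · intro F hF
      rw [(Finset.mem_filter.1 hF).2]
  · exact fun F _ => Finset.mem_Icc.2 ⟨G.size_pos F, G.size_le F⟩

theorem card_preimage {D Q : Type*} [Finite D] [Finite Q] (π : D → Q) (S : Set Q) :
    Nat.card {d // π d ∈ S} = ∑ᶠ s ∈ S, Nat.card {d // π d = s} := by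
  classical
  have := Fintype.ofFinite D
  simp only [finsum_mem_eq_finite_toFinset_sum _ S.toFinite, Nat.card_eq_fintype_card,
    Fintype.card_subtype]
  rw [Finset.card_eq_sum_card_fiberwise (f := π) (t := S.toFinite.toFinset)]
  · refine Finset.sum_congr rfl fun s hs => ?_
    congr 1
    ext d
    simp only [Finset.mem_filter, Finset.mem_univ, true_and, and_iff_right_iff_imp]
    rintro rfl
    simpa using hs
  · intro d hd
    simpa using hd

theorem card_preimage_of_card_fiber {D Q : Type*} [Finite D] [Finite Q] (π : D → Q) (S : Set Q)
    {n : ℕ} (h : ∀ s ∈ S, Nat.card {d // π d = s} = n) :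
    Nat.card {d // π d ∈ S} = n * S.ncard := by
  classical
  rw [card_preimage, finsum_mem_congr rfl h, finsum_mem_eq_finite_toFinset_sum _ S.toFinite,
    Finset.sum_const, smul_eq_mul, mul_comm, Set.ncard_eq_toFinset_card _ S.toFinite]

theorem curvature_eq (A : Set G.Face) :
    G.curvature A = 4 * (A.ncard : ℤ) - Nat.card {d // G.left d ∈ A} := by
  classical
  rw [curvature_eq_finsum, card_preimage, finsum_mem_eq_finite_toFinset_sum _ A.toFinite,
    finsum_mem_eq_finite_toFinset_sum _ A.toFinite, Set.ncard_eq_toFinset_card _ A.toFinite,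
    Finset.sum_sub_distrib, Finset.sum_const, nsmul_eq_mul, mul_comm]
  push_cast
  rfl

end Counting

end CombMap

/-! ### Rank and exactness. -/

theorem Matrix.finrank_ker_transpose {K m n : Type*} [Field K] [Fintype m] [Fintype n]
    [DecidableEq m] (M : Matrix m n K) :
    Module.finrank K (LinearMap.ker M.transpose.mulVecLin) + M.rank = Fintype.card m := by
  rw [← M.rank_transpose, Matrix.rank, add_comm, LinearMap.finrank_range_add_finrank_ker]
  simp

theorem Matrix.card_le_rank_add_one {K m n : Type*} [Field K] [Fintype m] [Fintype n]
    [DecidableEq n] (M : Matrix m n K) (h : ∀ g, M.mulVec g = 0 → ∀ i j, g i = g j) :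
    Fintype.card n ≤ M.rank + 1 := by
  have h1 : Module.finrank K (LinearMap.ker M.mulVecLin) ≤ 1 := by
    refine (Submodule.finrank_mono (t := K ∙ (1 : n → K)) fun g hg => ?_).trans
      (by simpa using finrank_span_le_card (R := K) {(1 : n → K)})
    rw [Submodule.mem_span_singleton]
    rcases isEmpty_or_nonempty n with hn | ⟨⟨i⟩⟩
    · exact ⟨0, Subsingleton.elim _ _⟩
    · exact ⟨g i, funext fun j => by simpa using h g hg i j⟩
  have h2 := LinearMap.finrank_range_add_finrank_ker M.mulVecLin
  rw [Module.finrank_fintype_fun_eq_card] at h2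
  rw [Matrix.rank]
  omega

/-- A complex `K ^ n → K ^ m → K ^ l` whose outer maps have constant kernels is exact in the
middle if its Euler characteristic is at least `2`. -/
theorem Matrix.exists_mulVec_eq_of_euler {K m n l : Type*} [Field K] [Fintype m] [Fintype n]
    [Fintype l] [DecidableEq m] [DecidableEq n] [DecidableEq l]
    {M : Matrix m n K} {N : Matrix m l K} (hMN : M.transpose * N = 0)
    (hM : ∀ g, M.mulVec g = 0 → ∀ i j, g i = g j) (hN : ∀ g, N.mulVec g = 0 → ∀ i j, g i = g j)
    (hcard : Fintype.card m + 2 ≤ Fintype.card n + Fintype.card l) {z : m → K}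
    (hz : M.transpose.mulVec z = 0) : ∃ w, N.mulVec w = z := by
  have h1 := M.finrank_ker_transpose
  have h2 := M.card_le_rank_add_one hM
  have h3 := N.card_le_rank_add_one hN
  have hle : LinearMap.range N.mulVecLin ≤ LinearMap.ker M.transpose.mulVecLin := by
    rintro _ ⟨w, rfl⟩
    rw [LinearMap.mem_ker, Matrix.mulVecLin_apply, Matrix.mulVecLin_apply, Matrix.mulVec_mulVec, hMN,
      Matrix.zero_mulVec]
  -- `dim ker Mᵀ = m - rank M ≤ m - n + 1 ≤ l - 1 ≤ rank N`.
  have heq := Submodule.eq_of_le_of_finrank_le hle (by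
    rw [Matrix.rank] at h3
    omega)
  have : z ∈ LinearMap.range N.mulVecLin := heq ▸ hz
  exact this

/-- The Euler–Poincaré relation for a complex `0 → K ^ l → K ^ m → K ^ n` that is exact except at
`K ^ n`, where the functions orthogonal to the image are the constants. -/
theorem Matrix.card_add_card_eq_of_exact {K m n l : Type*} [Field K] [Fintype m] [Fintype n]
    [Fintype l] [DecidableEq m] [DecidableEq n] [DecidableEq l] [Nonempty n]
    {M : Matrix m n K} {N : Matrix m l K} (hMN : M.transpose * N = 0)
    (hM : ∀ g, M.mulVec g = 0 ↔ ∀ i j, g i = g j) (hN : ∀ g, N.mulVec g = 0 → g = 0)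
    (hex : ∀ z, M.transpose.mulVec z = 0 → ∃ w, N.mulVec w = z) :
    Fintype.card n + Fintype.card l = Fintype.card m + 1 := by
  have h1 := M.finrank_ker_transpose
  have h2 := M.card_le_rank_add_one fun g => (hM g).1
  have h3 : M.rank + 1 ≤ Fintype.card n := by
    have h4 : 0 < Module.finrank K (LinearMap.ker M.mulVecLin) := by
      rw [Module.finrank_pos_iff_exists_ne_zero]
      refine ⟨⟨1, (hM 1).2 fun _ _ => rfl⟩, fun h => ?_⟩
      have := congrFun (congrArg Subtype.val h) (Classical.arbitrary n)
      simp at this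
    have h5 := LinearMap.finrank_range_add_finrank_ker M.mulVecLin
    rw [Module.finrank_fintype_fun_eq_card] at h5
    rw [Matrix.rank]
    omega
  have hle : LinearMap.ker M.transpose.mulVecLin = LinearMap.range N.mulVecLin := by
    apply le_antisymm
    · exact fun z hz => hex z hz
    · rintro _ ⟨w, rfl⟩
      rw [LinearMap.mem_ker, Matrix.mulVecLin_apply, Matrix.mulVecLin_apply, Matrix.mulVec_mulVec, hMN,
      Matrix.zero_mulVec]
  have h6 : Module.finrank K (LinearMap.range N.mulVecLin) = Fintype.card l := by
    rw [LinearMap.finrank_range_of_inj, Module.finrank_fintype_fun_eq_card]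
    rw [← LinearMap.ker_eq_bot, LinearMap.ker_eq_bot']
    exact hN
  rw [hle, h6] at h1
  omega

/-! ### Homology of the sphere modulo 2. -/

namespace CombMap

variable {D : Type*} {G : CombMap D}

/-- A property of the vertices that is carried along every edge holds everywhere or nowhere. -/
theorem eq_of_forall_tail_eq_head {α : Type*} (hG : G.IsPlane) {g : G.Vertex → α}
    (h : ∀ d, g (G.tail d) = g (G.head d)) (u v : G.Vertex) : g u = g v := by
  have := hG.connected.preconnected u v
  obtain ⟨p⟩ := this
  induction p with
  | nil => rfl
  | cons hadj _ ih =>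
    obtain ⟨_, d, rfl, rfl⟩ := hadj
    exact (h d).trans ih

/-- Turning about a vertex crosses one edge at a time, so `w` induces a function on vertices, and
connectedness of the graph applies to it. -/
theorem eq_of_forall_left_eq_left_rev {α : Type*} (hG : G.IsPlane) {w : G.Face → α}
    (h : ∀ d, w (G.left d) = w (G.left (G.rev d))) (F F' : G.Face) : w F = w F' := by
  have hrot : ∀ d, w (G.left (G.rot d)) = w (G.left d) := fun d => by
    rw [h, left_rev_rot]
  let g : G.Vertex → α := Quotient.lift (fun d => w (G.left d))
    fun _ _ h => Equiv.Perm.SameCycle.eq_of_forall_apply_eq h (f := fun d => w (G.left d)) hrot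
  obtain ⟨x, rfl⟩ := G.left_surjective F
  obtain ⟨y, rfl⟩ := G.left_surjective F'
  exact eq_of_forall_tail_eq_head (g := g) hG (fun d => h d) (G.tail x) (G.tail y)

/-- The incidence matrix modulo `2` between edges and classes of darts. -/
noncomputable def incidence [Fintype D] (G : CombMap D) {Q : Type*} (π : D → Q) :
    Matrix G.Edge Q (ZMod 2) :=
  open Classical in fun e q => ∑ d, if G.edge d = e ∧ π d = q then 1 else 0

section Incidence

variable [Fintype D] {Q : Type*} (π : D → Q)

theorem sum_edge_eq {α : Type*} [AddCommMonoid α] (G : CombMap D) (f : D → α) (d : D)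
    [DecidableEq G.Edge] :
    ∑ x, (if G.edge x = G.edge d then f x else 0) = f d + f (G.rev d) := by
  classical
  rw [← Finset.sum_filter, show Finset.univ.filter (fun x => G.edge x = G.edge d) = {d, G.rev d} by
    ext x
    simp only [Finset.mem_filter, Finset.mem_univ, true_and, Finset.mem_insert,
      Finset.mem_singleton]
    rw [eq_comm, edge_eq_iff], Finset.sum_pair (G.rev_ne d).symm]

/-- The two darts of an edge count separately, so a loop, or an edge with one face on both sides,
contributes `0` modulo 2. -/
theorem incidence_mulVec [Fintype Q] (g : Q → ZMod 2) (d : D) :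
    (G.incidence π).mulVec g (G.edge d) = g (π d) + g (π (G.rev d)) := by
  classical
  rw [← sum_edge_eq G (fun x => g (π x)) d]
  simp only [Matrix.mulVec, dotProduct, incidence, Finset.sum_mul]
  rw [Finset.sum_comm]
  refine Finset.sum_congr rfl fun x _ => ?_
  rw [Finset.sum_eq_single (π x)]
  · simp
  · intro q _ hq
    simp [hq.symm]
  · simp

theorem incidence_transpose_mulVec [Fintype G.Edge] [DecidableEq Q] (z : G.Edge → ZMod 2) (q : Q) :
    (G.incidence π).transpose.mulVec z q = ∑ d, if π d = q then z (G.edge d) else 0 := by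
  classical
  simp only [Matrix.mulVec, dotProduct, incidence, Finset.sum_mul, Matrix.transpose_apply]
  rw [Finset.sum_comm]
  refine Finset.sum_congr rfl fun x _ => ?_
  rw [Finset.sum_eq_single (G.edge x)]
  · simp
  · intro q _ hq
    simp [hq.symm]
  · simp

theorem incidence_mulVec_eq_zero_iff [Fintype Q] (g : Q → ZMod 2) :
    (G.incidence π).mulVec g = 0 ↔ ∀ d, g (π d) = g (π (G.rev d)) := by
  rw [funext_iff, G.edge_surjective.forall]
  simp only [incidence_mulVec, Pi.zero_apply, CharTwo.add_eq_zero]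

theorem incidence_tail_transpose_mul_left [Fintype G.Edge] [Fintype G.Face] :
    (G.incidence G.tail).transpose * G.incidence G.left = 0 := by
  classical
  refine Matrix.ext_of_mulVec_single fun F => ?_
  ext v
  rw [← Matrix.mulVec_mulVec, incidence_transpose_mulVec, Matrix.zero_mulVec, Pi.zero_apply]
  simp only [incidence_mulVec]
  rw [← Finset.sum_filter, Finset.sum_add_distrib, CharTwo.add_eq_zero]
  -- The sector between `d` and `rot d` is left of `d` and right of `rot d`, so the two sums agree.
  refine Finset.sum_nbij' (fun d => G.rot d) (fun d => G.rot⁻¹ d) ?_ ?_ ?_ ?_ ?_ <;>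
    simp [left_rev_rot]

end Incidence

section Exactness

theorem euler_card (hG : G.IsPlane) [Fintype G.Vertex] [Fintype G.Edge] [Fintype G.Face] :
    Fintype.card G.Vertex + Fintype.card G.Face = Fintype.card G.Edge + 2 := by
  have := hG.euler
  simp only [Nat.card_eq_fintype_card] at this
  omega

variable [Fintype D]

/-- On the sphere every cycle modulo `2` bounds. -/
theorem exists_face_potential (hG : G.IsPlane) [DecidableEq G.Vertex] (z : G.Edge → ZMod 2)
    (hz : ∀ v, ∑ d, (if G.tail d = v then z (G.edge d) else 0) = 0) :
    ∃ w : G.Face → ZMod 2, ∀ d, w (G.left d) + w (G.left (G.rev d)) = z (G.edge d) := by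
  classical
  have := Fintype.ofFinite G.Vertex
  have := Fintype.ofFinite G.Edge
  have := Fintype.ofFinite G.Face
  have hc := euler_card hG
  obtain ⟨w, hw⟩ := Matrix.exists_mulVec_eq_of_euler
    (incidence_tail_transpose_mul_left (G := G))
    (fun g hg => eq_of_forall_tail_eq_head hG ((incidence_mulVec_eq_zero_iff _ _).1 hg))
    (fun g hg => eq_of_forall_left_eq_left_rev hG ((incidence_mulVec_eq_zero_iff _ _).1 hg))
    (by omega) (z := z) (funext fun v => by rw [incidence_transpose_mulVec]; exact hz v)
  exact ⟨w, fun d => by rw [← incidence_mulVec, hw]⟩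

/-- On the sphere every cocycle modulo `2` is a coboundary. -/
theorem exists_vertex_potential (hG : G.IsPlane) [DecidableEq G.Face] (z : G.Edge → ZMod 2)
    (hz : ∀ F, ∑ d, (if G.left d = F then z (G.edge d) else 0) = 0) :
    ∃ g : G.Vertex → ZMod 2, ∀ d, g (G.tail d) + g (G.head d) = z (G.edge d) := by
  classical
  have := Fintype.ofFinite G.Vertex
  have := Fintype.ofFinite G.Edge
  have := Fintype.ofFinite G.Face
  have hc := euler_card hG
  -- The same criterion for the dual map: vertices and faces exchange roles.
  obtain ⟨g, hg⟩ := Matrix.exists_mulVec_eq_of_euler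
    (by
      rw [← Matrix.transpose_inj]
      simpa using incidence_tail_transpose_mul_left (G := G))
    (fun g hg => eq_of_forall_left_eq_left_rev hG ((incidence_mulVec_eq_zero_iff _ _).1 hg))
    (fun g hg => eq_of_forall_tail_eq_head hG ((incidence_mulVec_eq_zero_iff _ _).1 hg))
    (by omega) (z := z) (funext fun v => by rw [incidence_transpose_mulVec]; exact hz v)
  exact ⟨g, fun d => by rw [← hg, incidence_mulVec]; rfl⟩

end Exactness

end CombMap

/-! ### Patches are discs. -/

namespace CombMap

variable {D : Type*} {G : CombMap D} {A : Set G.Face} {q : ℕ}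

namespace PatchBoundary

variable (b : G.PatchBoundary A q)

instance : NeZero b.len := ⟨b.len_pos.ne'⟩

theorem circle_mem (i : ZMod b.len) : b.circle i ∈ G.boundary A :=
  b.range_eq ▸ Set.mem_range_self i

theorem left_circle (i : ZMod b.len) : G.left (b.circle i) ∈ A := (b.circle_mem i).1

theorem left_rev_circle (i : ZMod b.len) : G.left (G.rev (b.circle i)) ∉ A := (b.circle_mem i).2

theorem exists_circle_eq {d : D} (hd : d ∈ G.boundary A) : ∃ i, b.circle i = d := by
  rwa [← b.range_eq] at hd

theorem circle_injective : Function.Injective b.circle :=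
  Function.Injective.of_comp (f := G.tail) b.simple

theorem circle_add_one_eq {d : D} (hd : d ∈ G.boundary A) {i : ZMod b.len}
    (h : G.tail d = G.head (b.circle i)) : b.circle (i + 1) = d := by
  obtain ⟨j, rfl⟩ := b.exists_circle_eq hd
  rw [b.closed] at h
  rw [b.simple h]

/-- The boundary circle of a patch, run through backwards, bounds the complement. -/
def compl : G.PatchBoundary Aᶜ b.len where
  len := b.len
  len_pos := b.len_pos
  circle i := G.rev (b.circle (-i))
  closed i := by
    have h := b.closed (-(i + 1))
    rw [show -(i + 1) + 1 = -i by ring] at h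
    rw [head_rev, ← h]
    rfl
  simple i j h := by
    have h1 : G.head (b.circle (-i)) = G.head (b.circle (-j)) := h
    rw [b.closed, b.closed] at h1
    simpa using b.simple h1
  range_eq := by
    ext d
    constructor
    · rintro ⟨i, rfl⟩
      refine ⟨b.left_rev_circle _, ?_⟩
      rw [G.rev_rev]
      exact fun h => h (b.left_circle _)
    · rintro ⟨h1, h2⟩
      obtain ⟨i, hi⟩ := b.exists_circle_eq (d := G.rev d)
        ⟨not_not.1 h2, by rw [G.rev_rev]; exact h1⟩
      exact ⟨-i, by simp [hi, G.rev_rev]⟩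
  -- Marking every index as a break removes any demand of straightness; only the circle matters
  -- here.
  breaks := Finset.univ
  card_breaks := by rw [Finset.card_univ, ZMod.card]
  straight_of_notMem i hi := absurd (Finset.mem_univ i) hi

/-- A patch is connected: a function on its faces that takes the same value on both sides of
every inner edge is constant. -/
theorem eq_of_forall_left_eq [Finite D] (b : G.PatchBoundary A q) {α : Type*}
    (hG : G.IsPlane) (h4 : G.FourValent)
    {w : G.Face → α}
    (hw : ∀ d, G.left d ∈ A → G.left (G.rev d) ∈ A → w (G.left d) = w (G.left (G.rev d)))
    {F F' : G.Face} (hF : F ∈ A) (hF' : F' ∈ A) : w F = w F' := by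
  -- The sectors between two consecutive circle edges, on the side of `A`, are passed one by one;
  -- each crossing is an inner edge.
  have hstep : ∀ i, w (G.left (b.circle (i + 1))) = w (G.left (b.circle i)) := by
    intro i
    set x := b.circle (i + 1) with hx
    have hxA : G.left x ∈ A := b.left_circle _
    have hrot : ∀ y, G.left y ∈ A → G.left (G.rot y) ∈ A →
        w (G.left y) = w (G.left (G.rot y)) := fun y h1 h2 => by
      have := hw (G.rot y) h2 (by rwa [left_rev_rot])
      rw [this, left_rev_rot]
    have hiA := b.left_circle i
    have hiA' := b.left_rev_circle i
    have hr := G.rev_rev (b.circle i)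
    rcases eq_of_tail_eq h4 (b.closed i).symm with h | h | h | h
    · rw [h] at hiA'
      exact absurd hxA hiA'
    · rw [← hr, h, left_rev_rot]
    · rw [← hr, h, left_rev_rot] at hiA ⊢
      exact hrot _ hxA hiA
    -- Otherwise a third boundary edge would end at this vertex, which the circle visits only once.
    · have hx1 : G.left (G.rot x) ∈ A := by
        by_contra hx1
        obtain ⟨j, hj⟩ := b.exists_circle_eq (d := G.rev (G.rot x))
          ⟨by rwa [left_rev_rot], by rwa [G.rev_rev]⟩
        have h2 := b.closed j
        rw [hj, head_rev, tail_rot, hx] at h2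
        have h3 : i = j := by simpa using b.simple h2
        rw [← h3] at hj
        rw [hj, G.rev_rev] at h
        exact rot_rot_ne h4 _ h.symm
      rw [← hr, h, left_rev_rot] at hiA ⊢
      rw [hrot _ hxA hx1, hrot _ hx1 hiA]
  have hall : ∀ i, w (G.left (b.circle i)) = w (G.left (b.circle 0)) := by
    have hnat : ∀ n : ℕ, w (G.left (b.circle n)) = w (G.left (b.circle 0)) := by
      intro n
      induction n with
      | zero => simp
      | succ n ih => rw [Nat.cast_succ, hstep, ih]
    intro i
    rw [← ZMod.natCast_zmod_val i]
    exact hnat _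
  have key : ∀ F, F ∈ A → w F = w (G.left (b.circle 0)) := by
    intro F hF
    -- The faces of `A` with a wrong value form a set that no edge separates from its complement; as
    -- it misses a face at the circle, it is empty.
    have h1 := eq_of_forall_left_eq_left_rev hG
      (w := fun F => F ∈ A ∧ w F ≠ w (G.left (b.circle 0))) (fun d => by
        refine propext ?_
        by_cases hd : G.left d ∈ A <;> by_cases hd' : G.left (G.rev d) ∈ A
        · simp only [hd, hd', hw d hd hd']
        · obtain ⟨i, rfl⟩ := b.exists_circle_eq ⟨hd, hd'⟩
          simp [hd', hall]
        · obtain ⟨i, hi⟩ := b.exists_circle_eq (d := G.rev d) ⟨hd', by rwa [G.rev_rev]⟩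
          simp [hd, ← hi, hall]
        · simp [hd, hd']) F (G.left (b.circle 0))
    by_contra h2
    exact ((iff_of_eq h1).1 ⟨hF, h2⟩).2 rfl
  rw [key F hF, key F' hF']

end PatchBoundary

/-- The vertices of a region. -/
def verts (A : Set G.Face) : Set G.Vertex := {v | ∃ d, G.tail d = v ∧ G.left d ∈ A}

/-- The edges of a region. -/
def edges (A : Set G.Face) : Set G.Edge := {e | ∃ d, G.edge d = e ∧ G.left d ∈ A}

theorem tail_mem_verts {d : D} (h : G.left d ∈ A) : G.tail d ∈ verts A := ⟨d, rfl, h⟩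

theorem edge_mem_edges {d : D} : G.edge d ∈ edges A ↔ G.left d ∈ A ∨ G.left (G.rev d) ∈ A := by
  constructor
  · rintro ⟨x, hx, hA⟩
    rcases G.edge_eq_iff.1 hx with rfl | rfl
    · exact Or.inl hA
    · rw [G.rev_rev]
      exact Or.inr hA
  · rintro (h | h)
    · exact ⟨d, rfl, h⟩
    · exact ⟨G.rev d, G.edge_rev d, h⟩

theorem tail_mem_verts_of_edge_mem {d : D} (h : G.edge d ∈ edges A) : G.tail d ∈ verts A := by
  rcases edge_mem_edges.1 h with h | h
  · exact tail_mem_verts h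
  · rw [← G.head_rev, ← tail_next]
    exact tail_mem_verts (by rwa [left_next])

theorem head_mem_verts_of_edge_mem {d : D} (h : G.edge d ∈ edges A) : G.head d ∈ verts A :=
  tail_mem_verts_of_edge_mem (by rwa [edge_rev])

/-- Restricting the matrix amounts to extending functions by zero, so the incidence formulas of the
whole map serve for a patch. -/
theorem _root_.Matrix.submatrix_val_mulVec {K m n : Type*} [Field K] [Fintype n]
    (M : Matrix m n K) {S : Set m} {T : Set n} [Fintype T] (g : T → K) (i : S) :
    (M.submatrix Subtype.val Subtype.val).mulVec g i =
      M.mulVec (Function.extend Subtype.val g 0) i := by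
  refine Fintype.sum_of_injective _ Subtype.val_injective _ _ (fun j hj => ?_) fun j => ?_
  · rw [Function.extend_apply' _ _ _ hj]
    simp
  · rw [Subtype.val_injective.extend_apply]
    rfl

section Euler

variable [Fintype D]

/-- The chain complex of the closed region is exact apart from the constants on vertices; the count
is its Euler–Poincaré relation. -/
theorem PatchBoundary.ncard_verts_add (b : G.PatchBoundary A q) (hG : G.IsPlane)
    (h4 : G.FourValent) : (verts A).ncard + A.ncard = (edges A).ncard + 1 := by
  classical
  have := Fintype.ofFinite G.Vertex
  have := Fintype.ofFinite G.Edge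
  have := Fintype.ofFinite G.Face
  have : Nonempty (verts A) := ⟨⟨_, tail_mem_verts (b.left_circle 0)⟩⟩
  have hval : ∀ {X : Type _} {S : Set X} (g : S → ZMod 2) (x : X) (hx : x ∈ S),
      Function.extend Subtype.val g 0 x = g ⟨x, hx⟩ := fun g x hx =>
    Subtype.val_injective.extend_apply g 0 ⟨x, hx⟩
  have hzero : ∀ {X : Type _} {S : Set X} (g : S → ZMod 2) (x : X), x ∉ S →
      Function.extend Subtype.val g 0 x = 0 := fun g x hx =>
    Function.extend_apply' _ _ _ (by simpa using hx)
  rw [← Nat.card_coe_set_eq, ← Nat.card_coe_set_eq, ← Nat.card_coe_set_eq,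
    Nat.card_eq_fintype_card, Nat.card_eq_fintype_card, Nat.card_eq_fintype_card]
  refine Matrix.card_add_card_eq_of_exact
    (M := (G.incidence G.tail).submatrix (Subtype.val : edges A → _) (Subtype.val : verts A → _))
    (N := (G.incidence G.left).submatrix (Subtype.val : edges A → _) (Subtype.val : A → _))
    ?_ ?_ ?_ ?_
  · ext v F
    refine Eq.trans ?_ (congrFun (congrFun (incidence_tail_transpose_mul_left (G := G)) v.1) F.1)
    refine Fintype.sum_of_injective _ Subtype.val_injective _ _ (fun e he => ?_) fun e => rfl
    have h0 : G.incidence G.left e F = 0 := by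
      refine Finset.sum_eq_zero fun d _ => if_neg ?_
      rintro ⟨h1, h2⟩
      exact he ⟨⟨e, d, h1, h2 ▸ F.2⟩, rfl⟩
    exact mul_eq_zero_of_right _ h0
  · intro g
    have h0 : (((G.incidence G.tail).submatrix (Subtype.val : edges A → _)
        (Subtype.val : verts A → _)).mulVec g = 0) ↔ ∀ d, G.left d ∈ A →
        (Function.extend Subtype.val g 0 : _ → ZMod 2) (G.tail d) =
          (Function.extend Subtype.val g 0 : _ → ZMod 2) (G.head d) := by
      rw [funext_iff]
      constructor
      · intro h d hd
        have := h ⟨G.edge d, d, rfl, hd⟩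
        rwa [Matrix.submatrix_val_mulVec, incidence_mulVec, Pi.zero_apply,
          CharTwo.add_eq_zero] at this
      · rintro h ⟨_, d, rfl, hd⟩
        rw [Matrix.submatrix_val_mulVec, incidence_mulVec, Pi.zero_apply, CharTwo.add_eq_zero]
        exact h d hd
    rw [h0]
    constructor
    · intro h u v
      -- `g` is constant around each face of `A`, hence a function of faces; adjacent faces share a
      -- vertex, so it agrees on them.
      let w : G.Face → ZMod 2 := Quotient.lift
        (fun d => if G.left d ∈ A then (Function.extend Subtype.val g 0 : _ → ZMod 2) (G.tail d)
          else 0)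
        fun _ _ hs => Equiv.Perm.SameCycle.eq_of_forall_apply_eq hs (f := fun d =>
          if G.left d ∈ A then (Function.extend Subtype.val g 0 : _ → ZMod 2) (G.tail d) else 0) (by
          intro d
          rw [left_next, tail_next]
          split_ifs with hd
          · exact (h d hd).symm
          · rfl)
      have hw : ∀ d, G.left d ∈ A →
          w (G.left d) = (Function.extend Subtype.val g 0 : _ → ZMod 2) (G.tail d) :=
        fun d hd => if_pos hd
      obtain ⟨x, hxu, hx⟩ := u.2
      obtain ⟨y, hyv, hy⟩ := v.2
      rw [← hval g u.1 u.2, ← hval g v.1 v.2, ← hxu, ← hyv, ← hw x hx, ← hw y hy]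
      refine b.eq_of_forall_left_eq hG h4 (fun d hd hd' => ?_) hx hy
      rw [hw d hd, hw _ hd', h d hd]
      rfl
    · intro h d hd
      rw [hval g _ (tail_mem_verts hd), hval g _ (head_mem_verts_of_edge_mem ⟨d, rfl, hd⟩)]
      exact h _ _
  · intro w h0
    have h1 : ∀ d, (Function.extend Subtype.val w 0 : _ → ZMod 2) (G.left d) =
        (Function.extend Subtype.val w 0 : _ → ZMod 2) (G.left (G.rev d)) := by
      intro d
      by_cases hd : G.edge d ∈ edges A
      · have := congrFun h0 ⟨_, hd⟩
        rwa [Matrix.submatrix_val_mulVec, incidence_mulVec, Pi.zero_apply,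
          CharTwo.add_eq_zero] at this
      · rw [edge_mem_edges, not_or] at hd
        rw [hzero w _ hd.1, hzero w _ hd.2]
    funext F
    rw [← hval w F.1 F.2, eq_of_forall_left_eq_left_rev hG h1 F.1 _,
      hzero w _ (b.left_rev_circle 0)]
    rfl
  · intro z hz
    -- A cycle of the region bounds on the sphere. Its potential is constant off `A`, and
    -- subtracting that constant makes it live on `A`.
    obtain ⟨w, hw⟩ := exists_face_potential hG (Function.extend Subtype.val z 0) fun v => by
      by_cases hv : v ∈ verts A
      · rw [← incidence_transpose_mulVec, ← Matrix.submatrix_val_mulVec _ z ⟨v, hv⟩]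
        exact congrFun hz ⟨v, hv⟩
      · refine Finset.sum_eq_zero fun d _ => ?_
        split_ifs with hd
        · exact hzero z _ fun he => hv (hd ▸ tail_mem_verts_of_edge_mem he)
        · rfl
    have hconst : ∀ F, F ∉ A → w F = w (G.left (G.rev (b.circle 0))) := fun F hF =>
      b.compl.eq_of_forall_left_eq hG h4 (fun d hd hd' => by
        rw [← CharTwo.add_eq_zero, hw, hzero]
        rw [edge_mem_edges, not_or]
        exact ⟨hd, hd'⟩) hF (b.left_rev_circle 0)
    set c := w (G.left (G.rev (b.circle 0)))
    have hw' : ∀ F, (Function.extend Subtype.val (fun F : A => w F + c) 0 : _ → ZMod 2) F =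
        w F + c := by
      intro F
      by_cases hF : F ∈ A
      · exact hval _ _ hF
      · rw [hzero _ _ hF, hconst F hF, CharTwo.add_self_eq_zero]
    refine ⟨fun F => w F + c, ?_⟩
    ext ⟨_, d, rfl, hd⟩
    rw [Matrix.submatrix_val_mulVec, incidence_mulVec, hw', hw', add_add_add_comm,
      CharTwo.add_self_eq_zero, add_zero, hw, hval z _ ⟨d, rfl, hd⟩]

end Euler

/-! ### Gauss–Bonnet for regular patches. -/

section Curvature

theorem PatchBoundary.ncard_boundary (b : G.PatchBoundary A q) :
    (G.boundary A).ncard = b.len := by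
  rw [← b.range_eq, ← Nat.card_coe_set_eq, Nat.card_range_of_injective b.circle_injective,
    Nat.card_zmod]

/-- Of the two darts of an edge of the region, one that lacks `A` on its left is the reverse of a
boundary dart. -/
theorem two_mul_ncard_edges [Finite D] (A : Set G.Face) :
    2 * (edges A).ncard = {d | G.left d ∈ A}.ncard + (G.boundary A).ncard := by
  have h1 := card_preimage_of_card_fiber G.edge (edges A) fun e _ => G.card_edge_fiber e
  rw [← h1]
  have h2 : {d | G.edge d ∈ edges A} = {d | G.left d ∈ A} ∪ G.rev ⁻¹' G.boundary A := by
    ext d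
    simp only [edge_mem_edges, boundary, Set.mem_ofPred_eq, Set.mem_union, Set.mem_preimage,
      G.rev_rev]
    tauto
  have h3 : Nat.card {d // G.edge d ∈ edges A} = {d | G.edge d ∈ edges A}.ncard := rfl
  rw [h3, h2, Set.ncard_union_eq, Set.ncard_preimage_of_injective_subset_range G.rev.injective]
  · simp
  · rw [Set.disjoint_left]
    intro d hd hd'
    exact hd'.2 (by rwa [G.rev_rev])

/-- This second sector lies left of the incoming edge if the circle runs straight, and beside the
backward continuation of the new arc if it breaks. -/
theorem PatchBoundary.Regular.left_rot_circle {b : G.PatchBoundary A q} (hb : b.Regular)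
    (h4 : G.FourValent) (i : ZMod b.len) :
    G.left (G.rot (b.circle (i + 1))) ∈ A ↔ i ∉ b.breaks := by
  constructor
  · intro h hi
    have h1 := (hb i hi).2.2
    rw [left_rev_rot] at h1
    exact h1 h
  · intro hi
    rw [b.straight_of_notMem i hi, straight_eq, ← rot_inv_eq h4, ← left_rev, G.rev_rev]
    exact b.left_circle i

theorem PatchBoundary.Regular.left_rot_rot_circle {b : G.PatchBoundary A q} (hb : b.Regular)
    (h4 : G.FourValent) (i : ZMod b.len) :
    G.left (G.rot (G.rot (b.circle i))) ∉ A := by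
  obtain ⟨i, rfl⟩ : ∃ j, i = j + 1 := ⟨i - 1, by ring⟩
  by_cases hi : i ∈ b.breaks
  · exact (hb i hi).2.1
  · rw [b.straight_of_notMem i hi, straight_eq, rot_rot_rot_rot h4]
    exact b.left_rev_circle i

variable [Finite D]

/-- Counted from the outgoing boundary dart, the first sector at a circle vertex is in `A`, the last
two are not, and the second is outside exactly at a corner. `S3` collects these second sectors. -/
theorem PatchBoundary.Regular.four_mul_ncard_verts {b : G.PatchBoundary A q} (hb : b.Regular)
    (h4 : G.FourValent) :
    4 * (verts A).ncard = {d | G.left d ∈ A}.ncard + 2 * b.len + q := by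
  have h1 := card_preimage_of_card_fiber G.tail (verts A) fun v _ => h4 v
  rw [← h1]
  set S3 : Set D := {d | G.rot (G.rot (G.rot d)) ∈ G.boundary A ∧ G.left d ∉ A ∧
    G.left (G.rot d) ∉ A} with hS3
  have hr3 : ∀ d, G.left (G.rev d) = G.left (G.rot (G.rot (G.rot d))) := fun d => by
    rw [left_rev, rot_inv_eq h4]
  have h2 : {d | G.tail d ∈ verts A} = (({d | G.left d ∈ A} ∪ G.rot ⁻¹' G.boundary A) ∪
      (G.rot * G.rot) ⁻¹' G.boundary A) ∪ S3 := by
    ext d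
    simp only [boundary, Set.mem_ofPred_eq, Set.mem_union, Set.mem_preimage, Equiv.Perm.mul_apply,
      left_rev_rot, hS3]
    constructor
    · rintro ⟨x, hx, hxA⟩
      rcases eq_of_tail_eq h4 hx.symm with rfl | rfl | rfl | rfl <;> tauto
    · rintro (((h | h) | h) | h)
      · exact tail_mem_verts h
      · have := tail_mem_verts h.1
        simpa using this
      · have := tail_mem_verts h.1
        simpa using this
      · have := tail_mem_verts h.1.1
        simpa using this
  have hS3c : S3.ncard = q := by
    have : S3 = (fun i => G.rot (b.circle (i + 1))) '' (b.breaks : Set (ZMod b.len)) := by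
      ext d
      constructor
      · rintro ⟨h1, h2, h3⟩
        obtain ⟨j, hj⟩ := b.exists_circle_eq h1
        refine ⟨j - 1, ?_, ?_⟩
        · by_contra hbr
          have := (hb.left_rot_circle h4 (j - 1)).2 hbr
          rw [sub_add_cancel, hj, rot_rot_rot_rot h4] at this
          exact h2 this
        · simp only [sub_add_cancel]
          rw [hj, rot_rot_rot_rot h4]
      · rintro ⟨i, hi, rfl⟩
        refine ⟨?_, ?_, hb.left_rot_rot_circle h4 _⟩
        · rw [rot_rot_rot_rot h4]
          exact b.circle_mem _
        · rw [hb.left_rot_circle h4]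
          exact fun h => h hi
    rw [this, Set.ncard_image_of_injective _ fun i j h => by
      simpa using b.circle_injective (G.rot.injective h), Set.ncard_coe_finset, b.card_breaks]
  have h3 : Nat.card {d // G.tail d ∈ verts A} = {d | G.tail d ∈ verts A}.ncard := rfl
  rw [h3, h2, Set.ncard_union_eq, Set.ncard_union_eq, Set.ncard_union_eq, hS3c,
    Set.ncard_preimage_of_injective_subset_range G.rot.injective,
    Set.ncard_preimage_of_injective_subset_range (G.rot * G.rot).injective, b.ncard_boundary]
  · ring
  · simp
  · simp
  · rw [Set.disjoint_left]
    intro d hd hd'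
    refine hd'.2 ?_
    rwa [left_rev_rot]
  · rw [Set.disjoint_left]
    rintro d (hd | hd) hd'
    · obtain ⟨i, hi⟩ := b.exists_circle_eq hd'
      have := hb.left_rot_rot_circle h4 i
      rw [hi, Equiv.Perm.mul_apply, rot_rot_rot_rot h4] at this
      exact this hd
    · refine hd'.2 ?_
      rw [Equiv.Perm.mul_apply, left_rev_rot]
      exact hd.1
  · rw [Set.disjoint_left]
    rintro d ((hd | hd) | hd) hd'
    · exact hd'.2.1 hd
    · exact hd'.2.2 hd.1
    · have := hd'.1.2
      rw [left_rev_rot] at this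
      exact this hd.1

/-- The Gauss–Bonnet formula for regular patches. -/
theorem PatchBoundary.Regular.curvature_eq {b : G.PatchBoundary A q} (hb : b.Regular)
    (hG : G.IsPlane) (h4 : G.FourValent) : G.curvature A = 4 - (q : ℤ) := by
  have := Fintype.ofFinite D
  have h1 := hb.four_mul_ncard_verts h4
  have h2 := two_mul_ncard_edges A
  have h3 := b.ncard_verts_add hG h4
  rw [b.ncard_boundary] at h2
  rw [CombMap.curvature_eq, show Nat.card {d // G.left d ∈ A} = {d | G.left d ∈ A}.ncard from rfl]
  -- With `N` darts on the left: `4V = N + 2 len + q`, `2E = N + len`, `V + F = E + 1`.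
  omega

/-- A regular patch has curvature `4` exactly if a simple central circuit bounds it. -/
theorem PatchBoundary.Regular.eq_zero_iff {b : G.PatchBoundary A q} (hb : b.Regular) :
    q = 0 ↔ G.IsSimpleCentralCircuit (G.boundary A) := by
  constructor
  · intro hq
    have hbr : b.breaks = ∅ := by rw [← Finset.card_eq_zero, b.card_breaks, hq]
    have hs : ∀ i, b.circle (i + 1) = G.straight (b.circle i) := fun i =>
      b.straight_of_notMem i (by simp [hbr])
    have hpow : ∀ n : ℕ, b.circle n = (G.straight ^ n) (b.circle 0) := by
      intro n
      induction n with
      | zero => simp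
      | succ n ih => rw [Nat.cast_succ, hs, ih, pow_succ', Equiv.Perm.mul_apply]
    refine ⟨⟨b.circle 0, ?_⟩, ?_⟩
    · rw [← b.range_eq]
      ext e
      constructor
      · rintro ⟨i, rfl⟩
        refine ⟨(i.val : ℤ), ?_⟩
        rw [zpow_natCast, ← hpow, ZMod.natCast_zmod_val]
      · intro h
        obtain ⟨n, hn⟩ := Equiv.Perm.SameCycle.exists_nat_pow_eq h
        exact ⟨n, by rw [hpow, hn]⟩
    · rw [← b.range_eq]
      rintro _ ⟨i, rfl⟩ _ ⟨j, rfl⟩ h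
      rw [b.simple h]
  · rintro ⟨⟨d, hd⟩, -⟩
    rw [← b.card_breaks, Finset.card_eq_zero, Finset.eq_empty_iff_forall_notMem]
    intro i hi
    have h1 := b.circle_mem i
    rw [hd] at h1
    -- A break would continue outside `A`, yet the central circuit stays in the boundary.
    have h2 : G.straight (b.circle i) ∈ G.boundary A := by
      rw [hd]
      exact Equiv.Perm.SameCycle.apply_right h1
    exact (hb i hi).1.1 h2.1

end Curvature

end CombMap

/-! ### Rectangles. -/

namespace CombMap

variable {D : Type*} {G : CombMap D} {A : Set G.Face} {q : ℕ}

theorem IsRectangle.curvature_eq_zero [Finite D] (h : G.IsRectangle A) : G.curvature A = 0 := by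
  obtain ⟨a, b, f, h⟩ := h
  rw [curvature_eq_finsum, finsum_mem_congr rfl (g := fun _ => (0 : ℤ)), finsum_mem_zero]
  intro F hF
  rw [h.faces] at hF
  obtain ⟨i, hi, j, hj, rfl⟩ := hF
  simp [h.size_eq i hi j hj]

theorem size_eq_four_of_curvature_eq_zero [Finite D] (h : ∀ F ∈ A, G.size F ≤ 4)
    (hc : G.curvature A = 0) {F : G.Face} (hF : F ∈ A) : G.size F = 4 := by
  rw [curvature_eq_finsum, finsum_mem_eq_finite_toFinset_sum _ A.toFinite,
    Finset.sum_eq_zero_iff_of_nonneg] at hc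
  · have := hc F (by simpa using hF)
    omega
  · intro F hF
    have := h F (by simpa using hF)
    omega

namespace PatchBoundary.Regular

variable {b : G.PatchBoundary A q}

theorem straight_notMem (hb : b.Regular) {i : ZMod b.len} (hi : i ∈ b.breaks) :
    G.straight (b.circle i) ∉ G.boundary A := fun h => (hb i hi).1.1 h.1

variable [Finite D]

/-- Regularity excludes going straight or turning right, so every corner is a left turn, with a
single sector in `A`. -/
theorem circle_add_one_of_mem (hb : b.Regular) (h4 : G.FourValent) {i : ZMod b.len}
    (hi : i ∈ b.breaks) : b.circle (i + 1) = G.next (b.circle i) := by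
  have hA := b.left_circle (i + 1)
  obtain ⟨h1, h2⟩ := (hb i hi).1
  rw [straight_eq] at h1 h2
  rw [left_rev_rot] at h2
  rcases eq_of_tail_eq h4 (b.closed i) with h | h | h | h
  · rw [h] at hA
    exact absurd hA (b.left_rev_circle i)
  · rw [h] at hA
    exact absurd hA h2
  · rw [h] at hA
    exact absurd hA h1
  · rw [h, next_eq, rot_inv_eq h4]

/-- If the edge branching off to the left after `x` is an inner edge, the boundary runs straight
through `x`. -/
theorem mem_boundary_iff_straight (hb : b.Regular) (h4 : G.FourValent) {x : D}
    (hx : G.left x ∈ A) (hx' : G.left (G.rev (G.next x)) ∈ A) :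
    x ∈ G.boundary A ↔ G.straight x ∈ G.boundary A := by
  constructor
  · intro h
    obtain ⟨i, rfl⟩ := b.exists_circle_eq h
    by_cases hi : i ∈ b.breaks
    · have := b.left_rev_circle (i + 1)
      rw [hb.circle_add_one_of_mem h4 hi] at this
      exact absurd hx' this
    · rw [← b.straight_of_notMem i hi]
      exact b.circle_mem _
  · intro h
    obtain ⟨i, hi⟩ := b.exists_circle_eq h
    obtain ⟨i, rfl⟩ : ∃ j, i = j + 1 := ⟨i - 1, by ring⟩
    by_cases hbr : i ∈ b.breaks
    · rw [hb.circle_add_one_of_mem h4 hbr, straight_eq_next_rev_next h4,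
        G.next.injective.eq_iff] at hi
      have := b.left_rev_circle i
      rw [hi, G.rev_rev, left_next] at this
      exact absurd hx this
    · rw [b.straight_of_notMem i hbr, G.straight.injective.eq_iff] at hi
      rw [← hi]
      exact b.circle_mem i

end PatchBoundary.Regular

/-- From the lower side of a 4-gon to the lower side of the face above it. -/
def up (G : CombMap D) : Equiv.Perm D := G.rev * G.next * G.next

theorem up_eq (d : D) : G.up d = G.rev (G.next (G.next d)) := rfl

/-- The fourth side of the right neighbour is the edge shared with the face of `d`; both paths lead
to the dart next to it around its end. -/
theorem up_straight (h4 : G.FourValent) {d : D} (h : G.size (G.left (G.straight d)) = 4) :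
    G.up (G.straight d) = G.straight (G.up d) := by
  have h1 := next_of_size_eq_four h
  have h2 := straight_eq_next_rev_next h4 d
  nth_rewrite 2 [h2] at h1
  rw [G.next.injective.eq_iff] at h1
  rw [up_eq, ← rot_next, h1, straight_eq, up_eq, G.rev_rev, rot_next]

/-- The dart reached from `c` by `i` steps to the right and `j` steps up. -/
def gridDart (G : CombMap D) (c : D) (i j : ℕ) : D := (G.up ^ j) ((G.straight ^ i) c)

theorem gridDart_succ_right (c : D) (i j : ℕ) :
    G.gridDart c i (j + 1) = G.rev (G.next (G.next (G.gridDart c i j))) := by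
  rw [gridDart, pow_succ', Equiv.Perm.mul_apply, up_eq]
  rfl

/-- A dart `c`, whose grid of width `a` and height `h` lies in `A` with its sides in the
boundary of `A`. -/
structure IsGridStart (A : Set G.Face) (a h : ℕ) (c : D) : Prop where
  pos_left : 0 < a
  pos_right : 0 < h
  left_mem : ∀ i < a, ∀ j < h, G.left (G.gridDart c i j) ∈ A
  succ_left : ∀ i j, i + 1 < a → j < h → G.gridDart c (i + 1) j = G.straight (G.gridDart c i j)
  bottom : ∀ i < a, G.gridDart c i 0 ∈ G.boundary A
  right : ∀ j < h, G.next (G.gridDart c (a - 1) j) ∈ G.boundary A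
  top : ∀ i < a, G.next (G.next (G.gridDart c i (h - 1))) ∈ G.boundary A
  left : ∀ j < h, G.next (G.next (G.next (G.gridDart c 0 j))) ∈ G.boundary A

namespace PatchBoundary.Regular

variable [Finite D] {b : G.PatchBoundary A q}

/-- The bottom side is the arc after the break `s`; it is pushed upwards until some face of the row
leaves `A`. -/
theorem exists_isGridStart (hb : b.Regular) (h4 : G.FourValent) (hs : ∀ F ∈ A, G.size F = 4)
    {s : ZMod b.len} (hbr : s ∈ b.breaks) :
    ∃ a h, IsGridStart A a h (b.circle (s + 1)) ∧
      ∀ i < a, b.circle (s + 1 + i) = G.gridDart (b.circle (s + 1)) i 0 := by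
  classical
  have n4 : ∀ {d}, G.left d ∈ A → G.next (G.next (G.next (G.next d))) = d := fun h =>
    next_of_size_eq_four (hs _ h)
  -- Going round once returns to the break `s` itself.
  have hex : ∃ n : ℕ, s + 1 + n ∈ b.breaks :=
    ⟨(-1 : ZMod b.len).val, by rw [ZMod.natCast_zmod_val]; simpa using hbr⟩
  obtain ⟨n, hn, hmin⟩ : ∃ n : ℕ, s + 1 + n ∈ b.breaks ∧ ∀ m < n, s + 1 + m ∉ b.breaks :=
    ⟨Nat.find hex, Nat.find_spec hex, fun m hm => Nat.find_min hex hm⟩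
  set c := b.circle (s + 1) with hc
  have hwalk : ∀ i < n + 1, b.circle (s + 1 + i) = G.gridDart c i 0 := by
    intro i hi
    induction i with
    | zero => simp [gridDart, hc]
    | succ i ih =>
      rw [Nat.cast_succ, ← add_assoc, b.straight_of_notMem _ (hmin i (by omega)), ih (by omega),
        gridDart, gridDart, pow_succ' _ i]
      simp
  have hbot : ∀ i < n + 1, G.gridDart c i 0 ∈ G.boundary A := fun i hi => by
    rw [← hwalk i hi]
    exact b.circle_mem _
  -- `up` has finite order, so a sweep that never left `A` would return to `c` from below, through a
  -- face of `A`.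
  have hexit : ∃ j, ¬ ∀ i < n + 1, G.left (G.gridDart c i j) ∈ A := by
    by_contra! hall
    obtain ⟨m, hm⟩ := Nat.exists_eq_succ_of_ne_zero (orderOf_pos G.up).ne'
    have h1 : G.gridDart c 0 (m + 1) = c := by
      have : G.up ^ (m + 1) = 1 := by rw [← Nat.succ_eq_add_one, ← hm, pow_orderOf_eq_one]
      simp [gridDart, this]
    have h2 := b.left_rev_circle (s + 1)
    rw [← hc, ← h1, gridDart_succ_right, G.rev_rev, left_next, left_next] at h2
    exact h2 (hall m 0 (by omega))
  obtain ⟨h, hh, hin⟩ : ∃ h, (∃ i < n + 1, G.left (G.gridDart c i h) ∉ A) ∧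
      ∀ j < h, ∀ i < n + 1, G.left (G.gridDart c i j) ∈ A := by
    refine ⟨Nat.find hexit, by simpa using Nat.find_spec hexit, fun j hj => ?_⟩
    simpa using Nat.find_min hexit hj
  have hpos : 0 < h := by
    rw [Nat.pos_iff_ne_zero]
    rintro rfl
    obtain ⟨i, hi, hi'⟩ := hh
    exact hi' (hbot i hi).1
  have hsucc : ∀ j, j < h → ∀ i, i + 1 < n + 1 →
      G.gridDart c (i + 1) j = G.straight (G.gridDart c i j) := by
    intro j
    induction j with
    | zero =>
      intro _ i _
      simp [gridDart, pow_succ']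
    | succ j ih =>
      intro hj i hi
      have h1 := ih (by omega) i hi
      rw [gridDart_succ_right, ← up_eq, h1, up_straight h4, up_eq, gridDart_succ_right]
      rw [← h1]
      exact hs _ (hin j (by omega) _ hi)
  have hglue : ∀ j < h, ∀ i, i + 1 < n + 1 → G.rev (G.next (G.gridDart c i j)) =
      G.next (G.next (G.next (G.gridDart c (i + 1) j))) := by
    intro j hj i hi
    have h1 := hin j hj _ hi
    have h2 := hsucc j hj i hi
    rw [straight_eq_next_rev_next h4] at h2
    rw [h2, left_next] at h1
    rw [h2, n4 h1]
  have hrev : ∀ j i, G.rev (G.gridDart c i (j + 1)) = G.next (G.next (G.gridDart c i j)) := by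
    intro j i
    rw [gridDart_succ_right, G.rev_rev]
  refine ⟨n + 1, h, ⟨by omega, hpos, fun i hi j hj => hin j hj i hi,
    fun i j hi hj => hsucc j hj i hi, hbot, ?_, ?_, ?_⟩, hwalk⟩
  · intro j
    rw [Nat.add_sub_cancel]
    induction j with
    | zero =>
      intro _
      rw [← hwalk n (by omega), ← hb.circle_add_one_of_mem h4 hn]
      exact b.circle_mem _
    | succ j ih =>
      intro hj
      have h1 := ih (by omega)
      have h2 := hin (j + 1) hj n (by omega)
      rw [hb.mem_boundary_iff_straight h4 h1.1 (by rwa [← gridDart_succ_right]),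
        straight_eq_next_rev_next h4, ← gridDart_succ_right] at h1
      exact h1
  -- Along the top the boundary runs straight past inner edges, so one top side in the boundary
  -- brings all of them.
  · have hstep : ∀ i, i + 1 < n + 1 → (G.next (G.next (G.gridDart c i (h - 1))) ∈ G.boundary A ↔
        G.next (G.next (G.gridDart c (i + 1) (h - 1))) ∈ G.boundary A) := by
      intro i hi
      have h1 := hglue (h - 1) (by omega) i hi
      have h2 := hin (h - 1) (by omega) _ hi
      rw [hb.mem_boundary_iff_straight h4 (x := G.next (G.next (G.gridDart c (i + 1) (h - 1)))),
        straight_eq_next_rev_next h4, ← h1, G.rev_rev]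
      · rwa [left_next, left_next]
      · rw [← h1, G.rev_rev, left_next]
        exact hin (h - 1) (by omega) _ (by omega)
    have hall : ∀ i < n + 1, (G.next (G.next (G.gridDart c i (h - 1))) ∈ G.boundary A ↔
        G.next (G.next (G.gridDart c 0 (h - 1))) ∈ G.boundary A) := by
      intro i
      induction i with
      | zero => simp
      | succ i ih =>
        intro hi
        rw [← hstep i hi, ih (by omega)]
    obtain ⟨i, hi, hi'⟩ := hh
    obtain ⟨h, rfl⟩ := Nat.exists_eq_succ_of_ne_zero hpos.ne'
    simp only [Nat.succ_eq_add_one, Nat.add_sub_cancel] at *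
    intro i' hi2
    rw [hall i' hi2, ← hall i hi]
    rw [gridDart_succ_right] at hi'
    refine ⟨?_, hi'⟩
    rw [left_next, left_next]
    exact hin h (by omega) i hi
  · intro j
    induction j with
    | zero =>
      intro _
      have h1 : c = G.next (b.circle s) := hb.circle_add_one_of_mem h4 hbr
      have h2 : G.gridDart c 0 0 = c := rfl
      rw [h2, h1, n4 (b.left_circle s)]
      exact b.circle_mem s
    | succ j ih =>
      intro hj
      have h1 := hin j (by omega) 0 (by omega)
      have h2 := hin (j + 1) hj 0 (by omega)
      rw [hb.mem_boundary_iff_straight h4, straight_eq_next_rev_next h4, n4 h2, hrev]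
      · exact ih (by omega)
      · simpa using h2
      · rw [n4 h2, hrev, left_next, left_next]
        exact h1

end PatchBoundary.Regular

namespace IsGridStart

variable {a h : ℕ} {c : D}

theorem rev_next (g : IsGridStart A a h c) (h4 : G.FourValent) (hs : ∀ F ∈ A, G.size F = 4)
    {i j : ℕ} (hi : i + 1 < a) (hj : j < h) :
    G.rev (G.next (G.gridDart c i j)) = G.next (G.next (G.next (G.gridDart c (i + 1) j))) := by
  have h1 := g.left_mem _ hi j hj
  have h2 := g.succ_left i j hi hj
  rw [straight_eq_next_rev_next h4] at h2
  rw [h2, left_next] at h1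
  rw [h2, next_of_size_eq_four (hs _ h1)]

/-- The sides of the grid, run through one after the other, make up the boundary circle. -/
theorem circle_eq (g : IsGridStart A a h c) (b : G.PatchBoundary A q) (h4 : G.FourValent)
    (hs : ∀ F ∈ A, G.size F = 4) {s : ZMod b.len}
    (hbot : ∀ i < a, b.circle (s + i) = G.gridDart c i 0) :
    (∀ j < h, b.circle (s + (a + j : ℕ)) = G.next (G.gridDart c (a - 1) j)) ∧
    (∀ i < a, b.circle (s + (a + h + i : ℕ)) =
      G.next (G.next (G.gridDart c (a - 1 - i) (h - 1)))) ∧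
    (∀ j < h, b.circle (s + (a + h + a + j : ℕ)) =
      G.next (G.next (G.next (G.gridDart c 0 (h - 1 - j))))) ∧
    b.circle (s + (a + h + a + h : ℕ)) = c := by
  have ha := g.pos_left
  have hh := g.pos_right
  have hstep : ∀ {t : ℕ} {d d' : D}, b.circle (s + t) = d → d' ∈ G.boundary A →
      G.tail d' = G.head d → b.circle (s + (t + 1 : ℕ)) = d' := by
    rintro t _ d' rfl hd' ht
    rw [Nat.cast_succ, ← add_assoc]
    exact b.circle_add_one_eq hd' ht
  have hright : ∀ j < h, b.circle (s + (a + j : ℕ)) = G.next (G.gridDart c (a - 1) j) := by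
    intro j
    induction j with
    | zero =>
      intro hj
      rw [show a + 0 = a - 1 + 1 by omega]
      exact hstep (hbot (a - 1) (by omega)) (g.right 0 hj) (G.tail_next _)
    | succ j ih =>
      intro hj
      refine hstep (ih (by omega)) (g.right _ hj) ?_
      rw [gridDart_succ_right, ← straight_eq_next_rev_next h4, tail_straight]
  have htop : ∀ i < a, b.circle (s + (a + h + i : ℕ)) =
      G.next (G.next (G.gridDart c (a - 1 - i) (h - 1))) := by
    intro i
    induction i with
    | zero =>
      intro hi
      rw [show a + h + 0 = a + (h - 1) + 1 by omega]
      exact hstep (hright (h - 1) (by omega)) (g.top (a - 1) (by omega)) (G.tail_next _)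
    | succ i ih =>
      intro hi
      refine hstep (ih (by omega)) (g.top _ (by omega)) ?_
      have h1 := g.rev_next h4 hs (i := a - 1 - (i + 1)) (j := h - 1) (by omega) (by omega)
      rw [show a - 1 - (i + 1) + 1 = a - 1 - i by omega] at h1
      rw [← tail_straight, straight_eq_next_rev_next h4, ← h1, G.rev_rev]
  have hleft : ∀ j < h, b.circle (s + (a + h + a + j : ℕ)) =
      G.next (G.next (G.next (G.gridDart c 0 (h - 1 - j)))) := by
    intro j
    induction j with
    | zero =>
      intro hj
      rw [show a + h + a + 0 = a + h + (a - 1) + 1 by omega]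
      refine hstep (htop (a - 1) (by omega)) (g.left (h - 1) (by omega)) ?_
      rw [tail_next, Nat.sub_self, Nat.sub_zero]
    | succ j ih =>
      intro hj
      refine hstep (ih (by omega)) (g.left _ (by omega)) ?_
      have h1 := g.left_mem 0 ha (h - 1 - j) (by omega)
      rw [← tail_straight, straight_eq_next_rev_next h4, next_of_size_eq_four (hs _ h1),
        show h - 1 - j = h - 1 - (j + 1) + 1 by omega, gridDart_succ_right, G.rev_rev]
  refine ⟨hright, htop, hleft, ?_⟩
  rw [show a + h + a + h = a + h + a + (h - 1) + 1 by omega]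
  refine hstep (hleft (h - 1) (by omega)) (g.bottom 0 ha) ?_
  have h1 := g.left_mem 0 ha 0 hh
  rw [← tail_next, Nat.sub_self, next_of_size_eq_four (hs _ h1)]
  rfl

/-- The boundary circle with four breaks is not longer than the four sides of the grid. -/
theorem len_eq (g : IsGridStart A a h c) {b : G.PatchBoundary A 4} (hb : b.Regular)
    (h4 : G.FourValent) (hs : ∀ F ∈ A, G.size F = 4) {s : ZMod b.len}
    (hbot : ∀ i < a, b.circle (s + i) = G.gridDart c i 0) : b.len = a + h + a + h := by
  classical
  have ha := g.pos_left
  have hh := g.pos_right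
  obtain ⟨hright, htop, hleft, hclose⟩ := g.circle_eq b h4 hs hbot
  have hle : b.len ≤ a + h + a + h := by
    have h0 : b.circle (s + (0 : ℕ)) = c := hbot 0 ha
    have h1 := b.circle_injective (hclose.trans h0.symm)
    rw [add_right_inj, Nat.cast_zero, ZMod.natCast_eq_zero_iff] at h1
    exact Nat.le_of_dvd (by omega) h1
  by_contra hne
  -- On a shorter circle the offsets from `s` stop before the last corner. Away from the other three
  -- corners the straight continuation stays in the boundary, so at most three breaks are left.
  have hsub : b.breaks ⊆
      ({a - 1, a + h - 1, a + h + a - 1} : Finset ℕ).image fun t : ℕ => s + (t : ZMod b.len) := by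
    intro k hk
    have hval := ZMod.val_lt (k - s)
    have hks : s + ((k - s).val : ZMod b.len) = k := by
      rw [ZMod.natCast_zmod_val]
      ring
    have hst := hb.straight_notMem hk
    rw [← hks] at hst
    refine Finset.mem_image.2 ⟨_, ?_, hks⟩
    generalize (k - s).val = t at *
    simp only [Finset.mem_insert, Finset.mem_singleton]
    by_contra! ht
    obtain ⟨ht1, ht2, ht3⟩ := ht
    by_cases h1 : t < a
    · rw [hbot t h1, ← g.succ_left t 0 (by omega) hh] at hst
      exact hst (g.bottom _ (by omega))
    by_cases h2 : t < a + h
    · obtain ⟨j, rfl⟩ := Nat.exists_eq_add_of_le (not_lt.1 h1)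
      rw [hright j (by omega), straight_eq_next_rev_next h4, ← gridDart_succ_right] at hst
      exact hst (g.right _ (by omega))
    by_cases h3 : t < a + h + a
    · obtain ⟨i, rfl⟩ := Nat.exists_eq_add_of_le (not_lt.1 h2)
      have h1 := g.rev_next h4 hs (i := a - 1 - (i + 1)) (j := h - 1) (by omega) (by omega)
      rw [show a - 1 - (i + 1) + 1 = a - 1 - i by omega] at h1
      rw [htop i (by omega), straight_eq_next_rev_next h4, ← h1, G.rev_rev] at hst
      exact hst (g.top _ (by omega))
    · obtain ⟨j, rfl⟩ := Nat.exists_eq_add_of_le (not_lt.1 h3)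
      have h1 := g.left_mem 0 ha (h - 1 - j) (by omega)
      rw [hleft j (by omega), straight_eq_next_rev_next h4, next_of_size_eq_four (hs _ h1),
        show h - 1 - j = h - 1 - (j + 1) + 1 by omega, gridDart_succ_right, G.rev_rev] at hst
      exact hst (g.left _ (by omega))
  have hcard := (Finset.card_le_card hsub).trans Finset.card_image_le
  have := Finset.card_le_three (a := a - 1) (b := a + h - 1) (c := a + h + a - 1)
  rw [b.card_breaks] at hcard
  omega

/-- A repeated face gives two grid darts that differ by a number of quarter turns. Lowering the row
leads to the boundary, where the positions on the circle are distinct. -/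
theorem isGrid [Finite D] (g : IsGridStart A a h c) {b : G.PatchBoundary A 4} (hb : b.Regular)
    (hG : G.IsPlane) (h4 : G.FourValent) (hs : ∀ F ∈ A, G.size F = 4) {s : ZMod b.len}
    (hbot : ∀ i < a, b.circle (s + i) = G.gridDart c i 0) :
    G.IsGrid A a h (G.gridDart c) := by
  have ha := g.pos_left
  have hh := g.pos_right
  obtain ⟨hright, htop, -, -⟩ := g.circle_eq b h4 hs hbot
  have hlen := g.len_eq hb h4 hs hbot
  have hinj : ∀ t < a + h + a + h, ∀ t' < a + h + a + h,
      b.circle (s + (t : ℕ)) = b.circle (s + (t' : ℕ)) → t = t' := by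
    intro t ht t' ht' he
    have := b.circle_injective he
    rwa [add_right_inj, ZMod.natCast_eq_natCast_iff', Nat.mod_eq_of_lt (by omega),
      Nat.mod_eq_of_lt (by omega)] at this
  have n4 : ∀ i < a, ∀ j < h,
      G.next (G.next (G.next (G.next (G.gridDart c i j)))) = G.gridDart c i j := fun i hi j hj =>
    next_of_size_eq_four (hs _ (g.left_mem i hi j hj))
  have hrev : ∀ j i, G.rev (G.gridDart c i (j + 1)) = G.next (G.next (G.gridDart c i j)) := by
    intro j i
    rw [gridDart_succ_right, G.rev_rev]
  have hrevmem : ∀ i < a, ∀ j, j + 1 < h → G.gridDart c i (j + 1) ∉ G.boundary A := by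
    intro i hi j hj hmem
    have := hmem.2
    rw [hrev, left_next, left_next] at this
    exact this (g.left_mem i hi j (by omega))
  have h0 : ∀ j < h, ∀ j' < h, ∀ i < a, ∀ i' < a,
      G.gridDart c i j = G.gridDart c i' j' → i = i' ∧ j = j' := by
    intro j
    induction j with
    | zero =>
      rintro - (_ | j') hj' i hi i' hi' he
      · refine ⟨hinj i (by omega) i' (by omega) ?_, rfl⟩
        rw [hbot i hi, hbot i' hi', he]
      · exact absurd (he ▸ g.bottom i hi) (hrevmem i' hi' j' hj')
    | succ j ih =>
      rintro hj (_ | j') hj' i hi i' hi' he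
      · exact absurd (he ▸ g.bottom i' hi') (hrevmem i hi j hj)
      · rw [gridDart_succ_right, gridDart_succ_right] at he
        have := ih (by omega) j' (by omega) i hi i' hi'
          (G.next.injective (G.next.injective (G.rev.injective he)))
        exact ⟨this.1, by rw [this.2]⟩
  -- Under a quarter turn, one row down for the second dart is one column to the right for the
  -- first.
  have h1 : ∀ j' < h, ∀ i' < a, ∀ i < a, ∀ j < h,
      G.next (G.gridDart c i j) ≠ G.gridDart c i' j' := by
    intro j'
    induction j' with
    | zero =>
      intro _ i' hi' i hi j hj he
      have hm := g.bottom i' hi'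
      rw [← he] at hm
      obtain h2 | h2 : i + 1 < a ∨ i = a - 1 := by omega
      · have h3 := hm.2
        rw [g.rev_next h4 hs h2 hj, left_next, left_next, left_next] at h3
        exact h3 (g.left_mem _ h2 j hj)
      · subst h2
        rw [← hright j hj, ← hbot i' hi'] at he
        have := hinj _ (by omega) _ (by omega) he
        omega
    | succ j' ih =>
      intro hj' i' hi' i hi j hj he
      obtain h2 | h2 : i + 1 < a ∨ i = a - 1 := by omega
      · have h3 := g.rev_next h4 hs h2 hj
        rw [he, hrev] at h3
        exact ih (by omega) i' hi' (i + 1) h2 j hj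
          (G.next.injective (G.next.injective h3)).symm
      · subst h2
        exact hrevmem i' hi' j' hj' (he ▸ g.right j hj)
  -- Under a half turn, one row down for the second dart is one row up for the first.
  have h2 : ∀ j' < h, ∀ i' < a, ∀ i < a, ∀ j < h,
      G.next (G.next (G.gridDart c i j)) ≠ G.gridDart c i' j' := by
    intro j'
    induction j' with
    | zero =>
      intro _ i' hi' i hi j hj he
      have hm := g.bottom i' hi'
      rw [← he] at hm
      obtain h2 | h2 : j + 1 < h ∨ j = h - 1 := by omega
      · have h3 := hm.2
        rw [← gridDart_succ_right] at h3
        exact h3 (g.left_mem i hi _ h2)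
      · subst h2
        have h3 := htop (a - 1 - i) (by omega)
        rw [show a - 1 - (a - 1 - i) = i by omega] at h3
        rw [← h3, ← hbot i' hi'] at he
        have := hinj _ (by omega) _ (by omega) he
        omega
    | succ j' ih =>
      intro hj' i' hi' i hi j hj he
      obtain h2 | h2 : j + 1 < h ∨ j = h - 1 := by omega
      · have h3 := hrev j' i'
        rw [← he, ← gridDart_succ_right] at h3
        refine ih (by omega) i' hi' i hi (j + 1) h2 ?_
        rw [h3, n4 i' hi' j' (by omega)]
      · subst h2
        exact hrevmem i' hi' j' hj' (he ▸ g.top i hi)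
  refine ⟨ha, hh, ?_, ?_, fun i hi j hj => hs _ (g.left_mem i hi j hj),
    fun i j hi hj => g.rev_next h4 hs hi hj, fun i j _ _ => (gridDart_succ_right c i j).symm,
    fun i hi => (g.bottom i hi).2, fun i hi => (g.top i hi).2, fun j hj => (g.left j hj).2,
    fun j hj => (g.right j hj).2⟩
  -- No inner edge leads out of the grid, so connectedness of the patch makes it all of `A`.
  · have key : ∀ d, G.left (G.rev d) ∈ A →
        (∃ i < a, ∃ j < h, G.left (G.gridDart c i j) = G.left d) →
        ∃ i < a, ∃ j < h, G.left (G.gridDart c i j) = G.left (G.rev d) := by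
      rintro d hd' ⟨i, hi, j, hj, he⟩
      rcases eq_of_left_eq (hs _ (g.left_mem i hi j hj)) he with rfl | rfl | rfl | rfl
      · obtain _ | j := j
        · exact absurd hd' (g.bottom i hi).2
        · exact ⟨i, hi, j, by omega, by rw [hrev, left_next, left_next]⟩
      · obtain h3 | h3 : i + 1 < a ∨ i = a - 1 := by omega
        · exact ⟨i + 1, h3, j, hj, by rw [g.rev_next h4 hs h3 hj, left_next, left_next, left_next]⟩
        · subst h3
          exact absurd hd' (g.right j hj).2
      · obtain h3 | h3 : j + 1 < h ∨ j = h - 1 := by omega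
        · exact ⟨i, hi, j + 1, h3, by rw [gridDart_succ_right]⟩
        · subst h3
          exact absurd hd' (g.top i hi).2
      · obtain _ | i := i
        · exact absurd hd' (g.left j hj).2
        · exact ⟨i, by omega, j, hj, by rw [← g.rev_next h4 hs hi hj, G.rev_rev, left_next]⟩
    ext F
    constructor
    · intro hF
      have := b.eq_of_forall_left_eq hG h4
        (w := fun F => ∃ i < a, ∃ j < h, G.left (G.gridDart c i j) = F) (fun d hd hd' =>
          propext ⟨key d hd', fun hr => by
            simpa only [G.rev_rev] using key (G.rev d) (by rwa [G.rev_rev]) hr⟩)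
        hF (g.left_mem 0 ha 0 hh)
      exact (iff_of_eq this).2 ⟨0, ha, 0, hh, rfl⟩
    · rintro ⟨i, hi, j, hj, rfl⟩
      exact g.left_mem i hi j hj
  · intro i hi j hj i' hi' j' hj' he
    rcases eq_of_left_eq (hs _ (g.left_mem i hi j hj)) he with he | he | he | he
    · exact h0 j hj j' hj' i hi i' hi' he.symm
    · exact absurd he.symm (h1 j' hj' i' hi' i hi j hj)
    · exact absurd he.symm (h2 j' hj' i' hi' i hi j hj)
    -- Three quarter turns one way are one quarter turn the other way.
    · refine absurd ?_ (h1 j hj i hi i' hi' j' hj')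
      rw [he, n4 i hi j hj]

end IsGridStart

theorem PatchBoundary.Regular.isRectangle [Finite D] {b : G.PatchBoundary A 4} (hb : b.Regular)
    (hG : G.IsPlane) (h4 : G.FourValent) (hs : ∀ F ∈ A, G.size F = 4) : G.IsRectangle A := by
  obtain ⟨s, hbr⟩ : b.breaks.Nonempty := by
    rw [← Finset.card_pos, b.card_breaks]
    norm_num
  obtain ⟨a, h, g, hbot⟩ := hb.exists_isGridStart h4 hs hbr
  exact ⟨a, h, _, g.isGrid hb hG h4 hs hbot⟩

end CombMap

/-! ### 2-connected graphs and tilings. -/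

namespace CombMap

variable {D : Type*} [Finite D] {G : CombMap D} {A : Set G.Face}

/-- A closed curve entering the vertex by the sector of `x` and leaving by that of `y` splits its
darts; `ψ` marks those after `x` up to `y`. -/
theorem exists_sector [DecidableEq D] (h4 : G.FourValent) {x y : D} (ht : G.tail x = G.tail y) (hxy : x ≠ y) :
    ∃ ψ : D → ZMod 2, (∀ d, G.tail d ≠ G.tail x → ψ d = 0) ∧ ψ x = 0 ∧ ψ (G.rot x) = 1 ∧
      ∀ d, ψ d + ψ (G.rot d) = (Pi.single x 1 : D → ZMod 2) d + (Pi.single y 1 : D → ZMod 2) d := by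
  classical
  have n1 : ∀ d, G.rot d ≠ d := rot_ne h4
  have n2 : ∀ d, G.rot (G.rot d) ≠ d := rot_rot_ne h4
  have n3 : ∀ d, G.rot (G.rot (G.rot d)) ≠ d := fun d h => n1 d (by
    conv_lhs => rw [← h]
    exact rot_rot_rot_rot h4 d)
  have n4 := rot_rot_rot_rot h4
  have main : ∀ S : Set D, (∀ d ∈ S, G.tail d = G.tail x) → x ∉ S → G.rot x ∈ S →
      (G.rot (G.rot x) ∈ S ↔ y ≠ G.rot x) →
      (G.rot (G.rot (G.rot x)) ∈ S ↔ y = G.rot (G.rot (G.rot x))) →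
      ∃ ψ : D → ZMod 2, (∀ d, G.tail d ≠ G.tail x → ψ d = 0) ∧ ψ x = 0 ∧ ψ (G.rot x) = 1 ∧
        ∀ d, ψ d + ψ (G.rot d) = (Pi.single x 1 : D → ZMod 2) d + (Pi.single y 1 : D → ZMod 2) d := by
    intro S hS h0 h1 h2 h3
    refine ⟨fun d => if d ∈ S then 1 else 0, fun d hd => if_neg fun h => hd (hS d h),
      if_neg h0, if_pos h1, fun d => ?_⟩
    by_cases hd : G.tail x = G.tail d
    · rcases eq_of_tail_eq h4 ht with rfl | rfl | rfl | rfl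
      · exact absurd rfl hxy
      all_goals
        simp only [ne_eq, not_true, not_false_eq_true, iff_true, iff_false,
          EmbeddingLike.apply_eq_iff_eq, n1, (n1 _).symm, (n2 _).symm] at h2 h3
        rcases eq_of_tail_eq h4 hd with rfl | rfl | rfl | rfl <;>
        simp [CharTwo.add_self_eq_zero, h0, h1, h2, h3, n1, n2, n3, n4,
          (n1 _).symm, (n2 _).symm, (n3 _).symm]
    · have hd' : G.tail x ≠ G.tail (G.rot d) := by rwa [tail_rot]
      have e1 : d ∉ S := fun h => hd (hS d h).symm
      have e2 : G.rot d ∉ S := fun h => hd' (hS _ h).symm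
      have e3 : d ≠ x := fun h => hd (h ▸ rfl)
      have e4 : d ≠ y := fun h => hd (h ▸ ht)
      simp [e1, e2, e3, e4]
  refine main {d | d = G.rot x ∨ (d = G.rot (G.rot x) ∧ y ≠ G.rot x) ∨
    (d = G.rot (G.rot (G.rot x)) ∧ y = G.rot (G.rot (G.rot x)))} ?_ ?_ ?_ ?_ ?_
  · rintro d (rfl | ⟨rfl, -⟩ | ⟨rfl, -⟩) <;> simp
  all_goals simp [n1, n2, (n1 _).symm, (n2 _).symm, (n3 _).symm]

/-- In a 2-connected plane graph no face visits a vertex twice. -/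
theorem TwoConnected.eq_of_tail_eq_of_left_eq (h2 : G.TwoConnected) (hG : G.IsPlane)
    (h4 : G.FourValent) {x y : D} (ht : G.tail x = G.tail y) (hl : G.left x = G.left y) :
    x = y := by
  classical
  have := Fintype.ofFinite D
  by_contra hxy
  obtain ⟨ψ, hψ, hψx, hψx', hψs⟩ := exists_sector h4 ht hxy
  -- `z` counts crossings with the closed curve through the vertex and the face. The curve uses two
  -- sectors of one face, so `z` is a cocycle.
  let z : G.Edge → ZMod 2 := Quotient.lift (fun d => ψ d + ψ (G.rev d)) fun _ _ h =>
    Equiv.Perm.SameCycle.eq_of_forall_apply_eq h (f := fun d => ψ d + ψ (G.rev d)) fun d => by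
      rw [G.rev_rev, add_comm]
  have hz : ∀ d, z (G.edge d) = ψ d + ψ (G.rev d) := fun d => rfl
  obtain ⟨g, hg⟩ := exists_vertex_potential hG z fun F => by
    simp only [hz]
    rw [← Finset.sum_filter, Finset.sum_add_distrib]
    have h1 : ∑ d with G.left d = F, ψ (G.rev d) = ∑ d with G.left d = F, ψ (G.rot d) := by
      refine Finset.sum_nbij' (fun d => G.next d) (fun d => G.next.symm d) ?_ ?_ ?_ ?_ ?_
      · simp
      · intro d hd
        rw [Finset.mem_filter, ← left_next, Equiv.apply_symm_apply]
        simpa using hd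
      · simp
      · simp
      · simp [rot_next]
    rw [h1, ← Finset.sum_add_distrib, Finset.sum_congr rfl fun d _ => hψs d,
      Finset.sum_add_distrib, Finset.sum_pi_single', Finset.sum_pi_single']
    simp only [Finset.mem_filter, Finset.mem_univ, true_and, hl]
    exact CharTwo.add_self_eq_zero _
  have hconst : ∀ u u' : {u : G.Vertex | u ≠ G.tail x}, g u = g u' := by
    intro u u'
    obtain ⟨p⟩ := (h2.connected (G.tail x)).preconnected u u'
    induction p with
    | nil => rfl
    | @cons u v _ hadj _ ih =>
      obtain ⟨-, d, hd, hd'⟩ := hadj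
      rw [← ih]
      have h1 := hg d
      have hu : u.1 ≠ G.tail x := u.2
      have hv : v.1 ≠ G.tail x := v.2
      have e1 : G.tail d = u.1 := hd
      have e2 : G.head d = v.1 := hd'
      rw [hz, hψ d (by rwa [e1]), hψ (G.rev d) (by rw [← e2] at hv; exact hv), add_zero,
        CharTwo.add_eq_zero, e1, e2] at h1
      exact h1
  have hh : ∀ d, G.tail d = G.tail x → G.head d ≠ G.tail x := fun d hd h =>
    h2.no_loop d (hd.trans h.symm)
  -- The neighbours along `x` and `rot x` lie on different sides of the curve, yet `g` agrees on
  -- them.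
  have h5 := hg x
  have h6 := hg (G.rot x)
  have hx := hh x rfl
  have hx' := hh (G.rot x) (G.tail_rot x)
  rw [hz, hψx, hψ _ hx, add_zero] at h5
  rw [hz, hψx', hψ _ hx', add_zero, tail_rot, ← hconst ⟨_, hx⟩ ⟨_, hx'⟩, h5] at h6
  exact zero_ne_one h6

/-- In a 2-connected plane graph every face is a regular patch. -/
theorem TwoConnected.isRegularPatch_singleton (h2 : G.TwoConnected) (hG : G.IsPlane)
    (h4 : G.FourValent) (F : G.Face) : G.IsRegularPatch {F} (G.size F) := by
  obtain ⟨x, rfl⟩ := G.left_surjective F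
  have hpos := G.size_pos (G.left x)
  have : NeZero (G.size (G.left x)) := ⟨hpos.ne'⟩
  have hper := minimalPeriod_next (G := G) x
  have huniq : ∀ {d e : D}, G.tail d = G.tail e → G.left d = G.left e → d = e :=
    h2.eq_of_tail_eq_of_left_eq hG h4
  have hcast : ∀ n : ℕ, (G.next ^ (n : ZMod (G.size (G.left x))).val) x = (G.next ^ n) x := by
    intro n
    rw [ZMod.val_natCast, ← hper, ← Equiv.Perm.iterate_eq_pow, ← Equiv.Perm.iterate_eq_pow,
      Function.iterate_mod_minimalPeriod_eq]
  have hsucc : ∀ i : ZMod (G.size (G.left x)),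
      (G.next ^ (i + 1).val) x = G.next ((G.next ^ i.val) x) := by
    intro i
    have : i + 1 = ((i.val + 1 : ℕ) : ZMod (G.size (G.left x))) := by simp
    rw [this, hcast, pow_succ', Equiv.Perm.mul_apply]
  have hleft : ∀ n : ℕ, G.left ((G.next ^ n) x) = G.left x := fun n =>
    (G.left_eq_iff.2 (Equiv.Perm.SameCycle.refl _ _).pow_right).symm
  have hrev : ∀ d, G.left (G.rev d) ≠ G.left d := by
    intro d hd
    have h1 := huniq (d := G.rev d) (e := G.next d) (by rw [tail_next]; rfl)
      (by rw [hd, left_next])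
    have h5 := G.rot_next d
    rw [← h1] at h5
    exact rot_ne h4 _ h5
  refine ⟨{
    len := G.size (G.left x)
    len_pos := hpos
    circle := fun i => (G.next ^ i.val) x
    closed := fun i => by rw [hsucc, tail_next]
    simple := fun i j h => by
      have h1 : (G.next ^ i.val) x = (G.next ^ j.val) x := huniq h (by rw [hleft, hleft])
      rw [← Equiv.Perm.iterate_eq_pow, ← Equiv.Perm.iterate_eq_pow,
        Function.iterate_eq_iterate_iff_of_lt_minimalPeriod (by rw [hper]; exact ZMod.val_lt i)
        (by rw [hper]; exact ZMod.val_lt j)] at h1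
      exact ZMod.val_injective _ h1
    range_eq := by
      ext d
      constructor
      · rintro ⟨i, rfl⟩
        exact ⟨hleft _, fun h => hrev _ (h.trans (hleft _).symm)⟩
      · rintro ⟨h, -⟩
        obtain ⟨k, -, rfl⟩ := (G.left_eq_iff.1 h.symm).exists_lt_minimalPeriod
        exact ⟨k, hcast k⟩
    breaks := Finset.univ
    card_breaks := by rw [Finset.card_univ, ZMod.card]
    straight_of_notMem := fun i hi => absurd (Finset.mem_univ i) hi }, ?_⟩
  -- The face has one sector at each of its vertices, so the edge opposite to one of its sides does
  -- not touch it there.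
  have hout : ∀ d, G.left d = G.left x →
      G.Outside {G.left x} (G.rot (G.rot d)) := by
    intro d hd
    constructor
    · intro h
      exact rot_rot_ne h4 d (huniq (by simp) (h.trans hd.symm))
    · intro h
      rw [left_rev_rot] at h
      exact rot_ne h4 d (huniq (by simp) (h.trans hd.symm))
  intro i _
  refine ⟨?_, hout _ (hleft _)⟩
  set d := (G.next ^ i.val) x with hd
  have hn : G.left (G.next d) = G.left x := by rw [left_next, hd, hleft]
  constructor
  · intro h
    have h1 := huniq (d := G.straight d) (e := G.next d) (by rw [tail_straight, tail_next])
      (Eq.trans h hn.symm)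
    rw [straight_eq, next_eq, rot_inv_eq h4] at h1
    exact rot_ne h4 _ h1.symm
  · intro h
    rw [straight_eq, left_rev_rot] at h
    have h1 := huniq (d := G.rot (G.rev d)) (e := G.next d)
      (by rw [tail_rot, tail_next]; rfl) (Eq.trans h hn.symm)
    rw [next_eq, rot_inv_eq h4] at h1
    exact rot_rot_ne h4 _ h1.symm

theorem IsTiling.curvature_eq_sum {p : ℕ} {B : Fin p → Set G.Face} (h : G.IsTiling B A) :
    G.curvature A = ∑ i, G.curvature (B i) := by
  simp only [curvature_eq_finsum]
  rw [← h.2, finsum_mem_iUnion h.1 fun i => (B i).toFinite, finsum_eq_sum_of_fintype]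

/-- `4V = 2E = N` for `N` darts in all, so `4F - N = 4(V - E + F) = 8`. -/
theorem curvature_univ (hG : G.IsPlane) (h4 : G.FourValent) :
    G.curvature Set.univ = 8 := by
  have h1 := card_preimage_of_card_fiber G.tail Set.univ fun v _ => h4 v
  have h2 := card_preimage_of_card_fiber G.edge Set.univ fun e _ => G.card_edge_fiber e
  have h3 := hG.euler
  have h5 : Nat.card {d : D // G.left d ∈ (Set.univ : Set G.Face)} = Nat.card D :=
    Nat.card_congr (Equiv.subtypeUnivEquiv fun _ => Set.mem_univ _)
  have h6 : Nat.card {d : D // G.tail d ∈ (Set.univ : Set G.Vertex)} = Nat.card D :=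
    Nat.card_congr (Equiv.subtypeUnivEquiv fun _ => Set.mem_univ _)
  have h7 : Nat.card {d : D // G.edge d ∈ (Set.univ : Set G.Edge)} = Nat.card D :=
    Nat.card_congr (Equiv.subtypeUnivEquiv fun _ => Set.mem_univ _)
  rw [h6, Set.ncard_univ] at h1
  rw [h7, Set.ncard_univ] at h2
  rw [curvature_eq, h5, Set.ncard_univ]
  omega

/-- The single faces serve as tiles. -/
theorem TwoConnected.exists_tiling (h2 : G.TwoConnected) (hG : G.IsPlane) (h4 : G.FourValent)
    (A : Set G.Face) : ∃ (p : ℕ) (B : Fin p → Set G.Face) (q : Fin p → ℕ),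
      (∀ i, G.IsRegularPatch (B i) (q i)) ∧ G.IsTiling B A := by
  let e := Finite.equivFin A
  refine ⟨_, fun i => {((e.symm i : A) : G.Face)}, fun i => G.size (e.symm i : A),
    fun i => h2.isRegularPatch_singleton hG h4 _, fun i j hij => ?_, ?_⟩
  · refine Set.disjoint_singleton.2 ?_
    exact fun h => hij (e.symm.injective (Subtype.ext h))
  · ext F
    simp only [Set.mem_iUnion, Set.mem_singleton_iff]
    constructor
    · rintro ⟨i, rfl⟩
      exact (e.symm i).2
    · exact fun hF => ⟨e ⟨F, hF⟩, by rw [Equiv.symm_apply_apply]⟩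

end CombMap

theorem mainTheorem8 {D : Type*} [Finite D] (G : CombMap D) (hplane : G.IsPlane)
    (hfour : G.FourValent) :
    -- regular patches
    (∀ (A : Set G.Face) (q : ℕ), G.IsRegularPatch A q →
      G.curvature A = 4 - (q : ℤ) ∧
      (G.curvature A = 4 ↔ G.IsSimpleCentralCircuit (G.boundary A)) ∧
      (G.IsRectangle A → G.curvature A = 0) ∧
      ((∀ F ∈ A, G.size F ≤ 4) → (G.curvature A = 0 ↔ G.IsRectangle A))) ∧
    -- decomposition of a patch into regular patches
    (∀ A : Set G.Face, G.IsPatch A →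
      (G.TwoConnected → ∃ (p : ℕ) (B : Fin p → Set G.Face) (q : Fin p → ℕ),
        (∀ i, G.IsRegularPatch (B i) (q i)) ∧ G.IsTiling B A) ∧
      (∀ (p : ℕ) (B : Fin p → Set G.Face) (q : Fin p → ℕ),
        (∀ i, G.IsRegularPatch (B i) (q i)) → G.IsTiling B A →
          G.curvature A = ∑ i, (4 - (q i : ℤ)))) ∧
    -- patches that tile the whole graph
    (∀ (p : ℕ) (B : Fin p → Set G.Face),
      (∀ i, G.IsPatch (B i)) → G.IsTiling B Set.univ → ∑ i, G.curvature (B i) = 8) := by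
  refine ⟨?_, fun A _ => ⟨fun h2 => h2.exists_tiling hplane hfour A, ?_⟩, ?_⟩
  · rintro A q ⟨b, hb⟩
    have hc := hb.curvature_eq hplane hfour
    refine ⟨hc, ?_, CombMap.IsRectangle.curvature_eq_zero, fun hs =>
      ⟨fun h0 => ?_, CombMap.IsRectangle.curvature_eq_zero⟩⟩
    · rw [← hb.eq_zero_iff, hc]
      omega
    · obtain rfl : q = 4 := by omega
      exact hb.isRectangle hplane hfour fun F =>
        CombMap.size_eq_four_of_curvature_eq_zero hs h0
  · intro p B q hB hAB
    rw [hAB.curvature_eq_sum]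
    refine Finset.sum_congr rfl fun i _ => ?_
    obtain ⟨b, hb⟩ := hB i
    exact hb.curvature_eq hplane hfour
  · intro p B _ hB
    rw [← hB.curvature_eq_sum, CombMap.curvature_univ hplane hfour]
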